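/- A \emph{tract} $F=(G,N_G)$ is an abelian group $G$ with a subset $N_G\subseteq\mathbb N[G]$ such that $0\in N_G$, $1\notin N_G$, there is a unique $\epsilon\in G$ with $1+\epsilon\in N_G$ (write $-1=\epsilon$), and $G\cdot N_G\subseteq N_G$; we also write $F=G\cup\{0\}$ and $F^\times=G$. A homomorphism $f:F\to F'$ is a group homomorphism $G\to G'$ whose linear extension maps $N_G$ into $N_{G'}$; put $f(0)=0$. An involution of $F$ is a homomorphism $\tau:F\to F$ with $\tau^2=\mathrm{id}$. Let $E$ be a finite set; for $X\in F^E$ let $\underline X=\{e: X(e)\ne0\}$. A \emph{strong} (resp. \emph{weak}) $F$-matroid $M$ on $E$ is a set $\mathcal C=\mathcal C(M)\subseteq F^E$ (its $F$-circuits) such that $0\notin\mathcal C$; $F^\times\mathcal C\subseteq\mathcal C$; if $X,Y\in\mathcal C$ and $\underline X\subseteq\underline Y$ then $X=\alpha Y$ for some $\alpha\in F^\times$; and the following elimination axiom holds. * Weak: if $X,Y\in\mathcal C$, $\underline X\neq\underline Y$, $\underline X\cup\underline Y$ does not properly contain the union of two distinct supports of elements of $\mathcal C$, and $X(e)=-Y(e)\ne0$,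 then there is $Z\in\mathcal C$ with $Z(e)=0$ and $X(f)+Y(f)-Z(f)\in N_G$ for all $f\in E$. * Strong: if $X,X_1,\dots,X_k\in\mathcal C$ are such that $\underline X\cup\bigcup_i\underline X_i$ has height $k+1$ in the lattice of unions of supports of elements of $\mathcal C$, $\underline X\not\subseteq\bigcup_i\underline X_i$, and $e_i\in(\underline X\cap\underline X_i)\setminus\bigcup_{j\ne i}\underline X_j$ satisfies $X(e_i)=-X_i(e_i)$ for $1\le i\le k$, then there is $Z\in\mathcal C$ with $Z(e_i)=0$ for all $i$ and $X(f)+\sum_iX_i(f)-Z(f)\in N_G$ for all $f\in E$. Given an involution $x\mapsto\overline x$ of $F$, write $X\perp Y$ if $\sum_e X(e)\overline{Y(e)}\in N_G$. The \emph{$F$-cocircuits} of $M$ are the elements of minimal support among the nonzero $Y\in F^E$ such that $Y\perp X$ for all $X\in\mathcal C$ (strong case), resp. for all $X\in\mathcal C$ with $|\underline X\cap\underline Y|\le3$ (weak case). The dual $M^*$ is the $F$-matroid, of the same kind, whose $F$-circuits are the $F$-cocircuits of $M$. A \emph{strong} (resp. \emph{weak}) \emph{Grassmann–Plücker function} of rank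 $r$ is a not identically zero alternating function $\varphi:E^r\to F$ with $$\sum_{k=1}^{r+1}(-1)^k\varphi(x_1,\dots,\hat x_k,\dots,x_{r+1})\,\varphi(x_k,y_1,\dots,y_{r-1})\in N_G$$ for all subsets $I=\{x_1,\dots,x_{r+1}\}$, $J=\{y_1,\dots,y_{r-1}\}$ of $E$ of sizes $r+1$ and $r-1$ (resp. for those with $|I\setminus J|=3$, and such that the sets $\{x_1,\dots,x_r\}$ with $\varphi(x_1,\dots,x_r)\neq0$ are the bases of a matroid). It is a Grassmann–Plücker function of the $F$-matroid $M=M_\varphi$ whose $F$-circuits are the $X\in F^E$ such that $\underline X$ is a circuit of the matroid with these bases and $$\frac{X(x_i)}{X(x_0)}=(-1)^i\,\frac{\varphi(x_0,\dots,\hat x_i,\dots,x_r)}{\varphi(x_1,\dots,x_r)}$$ whenever $x_0\in\underline X$ and $\{x_1,\dots,x_r\}$ is a basis containing $\underline X\setminus\{x_0\}$. \textbf{Statement.} Let $f:F\to F'$ be a homomorphism of tracts endowed with involutions such that $f(\overline x)=\overline{f(x)}$ for all $x\in F$ (for instance, trivial involutions), and let $M$ be a strong (resp. weak) $F$-matroid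 on $E$. Then the dual strong (resp. weak) $F$-matroid $M^*$ exists, and there is a strong (resp. weak) $F'$-matroid $f_*(M)$ on $E$ such that: 1. the $F'$-circuits of $f_*(M)$ are $\{c'f_*(X): c'\in(F')^\times,\ X\in\mathcal C(M)\}$; 2. $f_*(M)$ is the unique strong (resp. weak) $F'$-matroid whose set of $F'$-cocircuits is $\{c'f_*(Y): c'\in(F')^\times,\ Y\in\mathcal C(M^*)\}$; 3. for every strong (resp. weak) Grassmann–Plücker function $\varphi$ of $M$, $f_*\varphi=f\circ\varphi$ is a strong (resp. weak) Grassmann–Plücker function, and $f_*(M)$ is the unique strong (resp. weak) $F'$-matroid with Grassmann–Plücker function $f_*\varphi$. In particular $f_*(M)$ has a dual strong (resp. weak) $F'$-matroid and $f_*(M)^*=f_*(M^*)$. -/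

import Mathlib

/-- A tract with multiplicative group `G`: a null set `N_G` in the group semiring `ℕ[G]`. -/
structure Tract (G : Type*) [CommGroup G] where
  /-- the null set `N_G` -/
  null : Set (MonoidAlgebra ℕ G)
  zero_mem : (0 : MonoidAlgebra ℕ G) ∈ null
  one_notMem : (1 : MonoidAlgebra ℕ G) ∉ null
  existsUnique_eps : ∃! ε : G, 1 + MonoidAlgebra.of ℕ G ε ∈ null
  smul_mem : ∀ (g : G) (a : MonoidAlgebra ℕ G), a ∈ null → MonoidAlgebra.of ℕ G g * a ∈ null

namespace Tract

variable {G : Type*} [CommGroup G] {G' : Type*} [CommGroup G'] {E : Type*}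

/-- The inclusion of `F = G ∪ {0}`, modelled as `WithZero G`, into `ℕ[G]`. -/
noncomputable def toSum : WithZero G → MonoidAlgebra ℕ G
  | 0 => 0
  | (g : G) => MonoidAlgebra.of ℕ G g

/-- The element `ε = -1` of `G`. -/
noncomputable def eps (T : Tract G) : G := T.existsUnique_eps.choose

/-- The element `-1` of `F`. -/
noncomputable def negOne (T : Tract G) : WithZero G := (T.eps : WithZero G)

/-- A homomorphism of tracts: a group homomorphism whose linear extension to the group
semirings maps the null set into the null set. -/
structure Hom (T : Tract G) (T' : Tract G') where
  toMonoidHom : G →* G'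
  map_null : ∀ a ∈ T.null, MonoidAlgebra.mapDomain toMonoidHom a ∈ T'.null

/-- The induced map `F → F'`, with `0 ↦ 0`. -/
noncomputable def Hom.map {T : Tract G} {T' : Tract G'} (f : Hom T T') :
    WithZero G → WithZero G' :=
  WithZero.map' f.toMonoidHom

/-- An involution of a tract. -/
structure Involution (T : Tract G) extends Hom T T where
  involutive : Function.Involutive toMonoidHom

/-! ### Supports, modular pairs and modular families -/

/-- The support of a vector. -/
def supp (X : E → WithZero G) : Set E := {e | X e ≠ 0}

/-- The vectors of minimal support in a set of vectors. -/
def suppMin (S : Set (E → WithZero G)) : Set (E → WithZero G) :=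
  {X | X ∈ S ∧ ∀ Y ∈ S, supp Y ⊆ supp X → supp Y = supp X}

/-- Modular pairs in a family `S` of subsets of `E`. -/
def IsModularPair (S : Set (Set E)) (A B : Set E) : Prop :=
  A ∈ S ∧ B ∈ S ∧ A ≠ B ∧ ∀ A' ∈ S, ∀ B' ∈ S, A' ≠ B' → ¬ (A' ∪ B' ⊂ A ∪ B)

/-- The lattice `U(S)` of unions of members of `S` (including the empty union),
ordered by inclusion. -/
def unionLattice (S : Set (Set E)) : Set (Set E) := {A | ∃ R ⊆ S, A = ⋃₀ R}

/-- A family of `n` members of `S` is modular if its join in the lattice `U(S)`, that is its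
union, has height `n` in that lattice. -/
def IsModularFamily (S : Set (Set E)) {n : ℕ} (A : Fin n → Set E) : Prop :=
  (∀ i, A i ∈ S) ∧
    ∃ h : (⋃ i, A i) ∈ unionLattice S, Order.height (⟨⋃ i, A i, h⟩ : unionLattice S) = n

/-! ### Matroids over tracts -/

/-- The two flavours of matroids over a tract. -/
inductive Flavour
  | weak
  | strong

/-- Modular elimination (the weak version). -/
def ModularElimination (T : Tract G) (C : Set (E → WithZero G)) : Prop :=
  ∀ X ∈ C, ∀ Y ∈ C, IsModularPair (supp '' C) (supp X) (supp Y) →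
    ∀ e : E, X e = T.negOne * Y e → X e ≠ 0 →
      ∃ Z ∈ C, Z e = 0 ∧ ∀ f, toSum (X f) + toSum (Y f) + toSum (T.negOne * Z f) ∈ T.null

/-- Strong modular elimination. In a family of `k + 1` vectors, the vector with index `0` is `X`
and the vector with index `i.succ` is `Xᵢ`. -/
def StrongModularElimination (T : Tract G) (C : Set (E → WithZero G)) : Prop :=
  ∀ (k : ℕ) (X : Fin (k + 1) → E → WithZero G) (e : Fin k → E),
    (∀ i, X i ∈ C) →
    IsModularFamily (supp '' C) (fun i => supp (X i)) →
    ¬ (supp (X 0) ⊆ ⋃ i : Fin k, supp (X i.succ)) →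
    (∀ i j : Fin k, j ≠ i → e i ∉ supp (X j.succ)) →
    (∀ i : Fin k, X 0 (e i) = T.negOne * X i.succ (e i) ∧ X 0 (e i) ≠ 0) →
    ∃ Z ∈ C, (∀ i, Z (e i) = 0) ∧
      ∀ f, (∑ i, toSum (X i f)) + toSum (T.negOne * Z f) ∈ T.null

/-- A strong or weak matroid over the tract `T` on `E`, given by its set of circuits. -/
@[ext]
structure FMatroid (k : Flavour) (T : Tract G) (E : Type*) where
  circuits : Set (E → WithZero G)
  zero_notMem : (0 : E → WithZero G) ∉ circuits
  smul_mem : ∀ X ∈ circuits, ∀ α : G, (fun e => (α : WithZero G) * X e) ∈ circuits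
  incomparable : ∀ X ∈ circuits, ∀ Y ∈ circuits, supp X ⊆ supp Y →
    ∃ α : G, X = fun e => (α : WithZero G) * Y e
  elimination : match k with
    | .weak => ModularElimination T circuits
    | .strong => StrongModularElimination T circuits

/-! ### Orthogonality and cocircuits -/

/-- The inner product of `X` and `Y` as an element of `ℕ[G]`. -/
noncomputable def dot [Fintype E] {T : Tract G} (τ : Involution T) (X Y : E → WithZero G) :
    MonoidAlgebra ℕ G :=
  ∑ e, toSum (X e * τ.map (Y e))

/-- `X ⊥ Y` -/
def Orthogonal [Fintype E] {T : Tract G} (τ : Involution T) (X Y : E → WithZero G) : Prop :=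
  dot τ X Y ∈ T.null

/-- The orthogonal complement of a set `C` of vectors. For strong matroids this is `C^⊥`. For weak
matroids orthogonality is only required of vectors whose supports share at most 3 elements, as in
the definition of a weak dual pair. -/
def orthComplement [Fintype E] (k : Flavour) {T : Tract G} (τ : Involution T)
    (C : Set (E → WithZero G)) : Set (E → WithZero G) :=
  match k with
  | .strong => {Y | ∀ X ∈ C, Orthogonal τ Y X}
  | .weak => {Y | ∀ X ∈ C, (supp Y ∩ supp X).ncard ≤ 3 → Orthogonal τ Y X}

/-- The cocircuits of `M`: the nonzero vectors of minimal support in the orthogonal complement of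
the set of circuits. -/
def FMatroid.cocircuits [Fintype E] {k : Flavour} {T : Tract G} (τ : Involution T)
    (M : FMatroid k T E) : Set (E → WithZero G) :=
  suppMin (orthComplement k τ M.circuits \ {0})

/-- `N` is the dual matroid of `M`: its circuits are the cocircuits of `M`. -/
def FMatroid.IsDual [Fintype E] {k : Flavour} {T : Tract G} (τ : Involution T)
    (M N : FMatroid k T E) : Prop :=
  N.circuits = M.cocircuits τ

/-! ### Grassmann-Plücker functions -/

/-- `M` is the classical matroid on `E` whose bases are the sets `{x₁, …, xᵣ}` with
`φ(x₁, …, xᵣ) ≠ 0`. -/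
def IsUnderlyingMatroid {r : ℕ} (φ : (Fin r → E) → WithZero G) (M : Matroid E) : Prop :=
  M.E = Set.univ ∧ ∀ B : Set E, M.IsBase B ↔ ∃ x : Fin r → E, Set.range x = B ∧ φ x ≠ 0

/-- The left-hand side of the Grassmann-Plücker relation for `x₁, …, xᵣ₊₁` and `y₁, …, yᵣ₋₁`,
where `r = s + 1`. The index `k : Fin (s + 2)` starts at `0`. -/
noncomputable def gpSum (T : Tract G) {s : ℕ} (φ : (Fin (s + 1) → E) → WithZero G)
    (x : Fin (s + 2) → E) (y : Fin s → E) : MonoidAlgebra ℕ G :=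
  ∑ k : Fin (s + 2),
    toSum (T.negOne ^ ((k : ℕ) + 1) * (φ (x ∘ k.succAbove) * φ (Fin.cons (x k) y)))

/-- All Grassmann-Plücker relations (there are none in rank `0`). -/
def GPRelations (T : Tract G) : {r : ℕ} → ((Fin r → E) → WithZero G) → Prop
  | 0, _ => True
  | s + 1, φ => ∀ (x : Fin (s + 2) → E) (y : Fin s → E),
      Function.Injective x → Function.Injective y → gpSum T φ x y ∈ T.null

/-- The 3-term Grassmann-Plücker relations (there are none in rank `0`). -/
def ThreeTermGPRelations (T : Tract G) : {r : ℕ} → ((Fin r → E) → WithZero G) → Prop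
  | 0, _ => True
  | s + 1, φ => ∀ (x : Fin (s + 2) → E) (y : Fin s → E),
      Function.Injective x → Function.Injective y →
      (Set.range x \ Set.range y).ncard = 3 → gpSum T φ x y ∈ T.null

/-- Strong and weak Grassmann-Plücker functions of rank `r` on `E`. -/
structure IsGPFunction (k : Flavour) (T : Tract G) {r : ℕ} (φ : (Fin r → E) → WithZero G) :
    Prop where
  exists_ne_zero : ∃ x, φ x ≠ 0
  map_swap : ∀ (x : Fin r → E) (i j : Fin r), i ≠ j → φ (x ∘ Equiv.swap i j) = T.negOne * φ x
  map_eq_zero : ∀ (x : Fin r → E) (i j : Fin r), i ≠ j → x i = x j → φ x = 0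
  relations : match k with
    | .strong => GPRelations T φ
    | .weak => (∃ M : Matroid E, IsUnderlyingMatroid φ M) ∧ ThreeTermGPRelations T φ

/-- The circuits `C_φ` given by a Grassmann-Plücker function `φ`: the vectors `X` supported on a
circuit of the underlying matroid of `φ` such that
`X(xᵢ) / X(x₀) = (-1)ⁱ φ(x₀, …, x̂ᵢ, …, xᵣ) / φ(x₁, …, xᵣ)`
whenever `x₀` lies in the support of `X` and `{x₁, …, xᵣ}` is a basis containing the rest of the
support. -/
def gpCircuits (T : Tract G) {r : ℕ} (φ : (Fin r → E) → WithZero G) : Set (E → WithZero G) :=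
  {X | ∃ M : Matroid E, IsUnderlyingMatroid φ M ∧ M.IsCircuit (supp X) ∧
    ∀ x : Fin (r + 1) → E, x 0 ∈ supp X → φ (x ∘ Fin.succ) ≠ 0 →
      supp X \ {x 0} ⊆ Set.range (x ∘ Fin.succ) →
      ∀ i : Fin (r + 1),
        X (x i) / X (x 0) = T.negOne ^ (i : ℕ) * (φ (x ∘ i.succAbove) / φ (x ∘ Fin.succ))}

/-- `φ` is a (strong or weak) Grassmann-Plücker function of the matroid `M`, that is `M = M_φ`. -/
def FMatroid.HasGPFunction {k : Flavour} {T : Tract G} (M : FMatroid k T E) {r : ℕ}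
    (φ : (Fin r → E) → WithZero G) : Prop :=
  IsGPFunction k T φ ∧ M.circuits = gpCircuits T φ

/-! ### Push-forward -/

/-- The set of all `c' f_*(X)` with `c' ∈ (F')ˣ` and `X ∈ C`. -/
def Hom.pushSet {T : Tract G} {T' : Tract G'} (f : Hom T T') (C : Set (E → WithZero G)) :
    Set (E → WithZero G') :=
  {X' | ∃ c' : G', ∃ X ∈ C, X' = fun e => (c' : WithZero G') * f.map (X e)}

/-- The push-forward `f_* φ` of a function `φ : Eʳ → F`. -/
noncomputable def Hom.pushGP {T : Tract G} {T' : Tract G'} (f : Hom T T') {r : ℕ}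
    (φ : (Fin r → E) → WithZero G) : (Fin r → E) → WithZero G' :=
  fun x => f.map (φ x)

end Tract

/-! The supports of the circuits are the circuits of an ordinary matroid `M`. On each circuit of `M`
there is one projective class of vectors, which is what `IsSignature` records. Since the height of a
union of circuits is its nullity (`height_unionLattice`), modular families become rank conditions in
`M`, and both flavours are treated together: the weak one allows elimination with one auxiliary
vector and orthogonality for intersections of at most three elements, the strong one allows
everything.

The heart is that elimination for a signature and orthogonality to vectors on all cocircuits
determine each other. From elimination to orthogonality: let `D` be a cocircuit. Circuits meeting
`D` in exactly `{e, f}` all have the same ratio of values at `e` and `f`, because one can move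
between them by exchanging elements in a basis of the hyperplane complementary to `D`. Eliminating a
common element of `D` makes these ratios multiply consistently, so they come from one vector `W` on
`D` (`exists_perp`). Larger intersections reduce to two elements by eliminating the others
(`perp_of_eliminationAt`). From orthogonality to elimination: the support of the vector `Z` required
by elimination must be a fundamental circuit, and its relation at `f` is orthogonality of the given
`X` to the vector on a fundamental cocircuit through `f` (`eliminationAt_of_perp`).

Circuits of `M` are cocircuits of `M✶`, so the second implication, applied in `M✶`, shows that
cocircuits satisfy elimination; hence duals exist, and a matroid is recovered from its cocircuits
(`IsDual.symm`).

A homomorphism of tracts preserves null sums and sends no nonzero element to zero, so it preserves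
supports, the underlying matroid, elimination and orthogonality. One inclusion is then immediate for
cocircuits and for Grassmann–Plücker circuits; equality follows because both sides have the same
supports and one projective class on each. For a Grassmann–Plücker function this needs a vector on
every circuit of its matroid (`exists_mem_gpCircuits`), which rests on three-term relations with one
vanishing term. -/

namespace Tract

variable {G : Type*} [CommGroup G] {G' : Type*} [CommGroup G'] {E : Type*}

/-! ### Arithmetic in tracts -/

@[simp] lemma toSum_zero : toSum (0 : WithZero G) = 0 := rfl

@[simp] lemma toSum_coe (g : G) : toSum (g : WithZero G) = MonoidAlgebra.of ℕ G g := rfl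

@[simp] lemma toSum_one : toSum (1 : WithZero G) = 1 :=
  (MonoidAlgebra.of ℕ G).map_one

lemma toSum_mul (a b : WithZero G) : toSum (a * b) = toSum a * toSum b := by
  induction a with
  | zero => simp
  | coe g =>
    induction b with
    | zero => simp
    | coe h => rw [← WithZero.coe_mul, toSum_coe, toSum_coe, toSum_coe, map_mul]

lemma null_smul (T : Tract G) (a : WithZero G) {n : MonoidAlgebra ℕ G} (hn : n ∈ T.null) :
    toSum a * n ∈ T.null := by
  induction a with
  | zero => simpa using T.zero_mem
  | coe g => exact T.smul_mem g n hn

lemma null_smul_iff (T : Tract G) {a : WithZero G} (ha : a ≠ 0) {n : MonoidAlgebra ℕ G} :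
    toSum a * n ∈ T.null ↔ n ∈ T.null := by
  refine ⟨fun h => ?_, T.null_smul a⟩
  have := T.null_smul a⁻¹ h
  rwa [← mul_assoc, ← toSum_mul, inv_mul_cancel₀ ha, toSum_one, one_mul] at this

lemma toSum_mem_null_iff (T : Tract G) {a : WithZero G} : toSum a ∈ T.null ↔ a = 0 := by
  refine ⟨fun h => ?_, fun h => h ▸ T.zero_mem⟩
  by_contra ha
  have : toSum a * 1 ∈ T.null := by rwa [mul_one]
  exact T.one_notMem ((T.null_smul_iff ha).1 this)

lemma one_add_negOne (T : Tract G) : toSum 1 + toSum T.negOne ∈ T.null := by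
  rw [toSum_one]
  exact T.existsUnique_eps.choose_spec.1

lemma negOne_ne_zero (T : Tract G) : T.negOne ≠ 0 := WithZero.coe_ne_zero

lemma eq_negOne_of_one_add (T : Tract G) {a : WithZero G} (h : toSum 1 + toSum a ∈ T.null) :
    a = T.negOne := by
  induction a with
  | zero => exact absurd ((T.toSum_mem_null_iff).1 (by simpa using h)) one_ne_zero
  | coe g =>
    rw [toSum_one] at h
    exact congrArg _ (T.existsUnique_eps.choose_spec.2 g h)

-- Scaling the null element `1 + ε` by `ε⁻¹` gives `ε⁻¹ + 1`, so uniqueness of `ε` forces `ε⁻¹ = ε`.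
@[simp] lemma negOne_mul_negOne (T : Tract G) : T.negOne * T.negOne = 1 := by
  have h := T.null_smul T.negOne⁻¹ T.one_add_negOne
  rw [mul_add, ← toSum_mul, ← toSum_mul, mul_one, inv_mul_cancel₀ T.negOne_ne_zero, add_comm] at h
  have h' := T.eq_negOne_of_one_add h
  nth_rw 1 [← h']
  exact inv_mul_cancel₀ T.negOne_ne_zero

@[simp] lemma negOne_mul_cancel_left (T : Tract G) (a : WithZero G) :
    T.negOne * (T.negOne * a) = a := by
  rw [← mul_assoc, negOne_mul_negOne, one_mul]

lemma add_mem_null_iff (T : Tract G) {a b : WithZero G} :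
    toSum a + toSum b ∈ T.null ↔ a = T.negOne * b := by
  by_cases ha : a = 0
  · subst ha
    simp [T.toSum_mem_null_iff, T.negOne_ne_zero]
  · have h1 : toSum a + toSum b = toSum a * (toSum 1 + toSum (a⁻¹ * b)) := by
      rw [mul_add, ← toSum_mul, ← toSum_mul, mul_one, mul_inv_cancel_left₀ ha]
    rw [h1, T.null_smul_iff ha]
    constructor
    · intro h
      have : b = T.negOne * a := by
        rw [← T.eq_negOne_of_one_add h, mul_comm, mul_inv_cancel_left₀ ha]
      rw [this, T.negOne_mul_cancel_left]
    · intro h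
      have : b = T.negOne * a := by rw [h, T.negOne_mul_cancel_left]
      rw [this, mul_comm, mul_inv_cancel_right₀ ha]
      exact T.one_add_negOne

lemma add_negOne_mem_null_iff (T : Tract G) {a b : WithZero G} :
    toSum a + toSum (T.negOne * b) ∈ T.null ↔ a = b := by
  rw [add_mem_null_iff, negOne_mul_cancel_left]

/-! ### Homomorphisms -/

variable {T : Tract G} {T' : Tract G'}

@[simp] lemma Hom.map_zero (f : Hom T T') : f.map 0 = 0 := _root_.map_zero (WithZero.map' f.toMonoidHom)

@[simp] lemma Hom.map_coe (f : Hom T T') (g : G) : f.map g = (f.toMonoidHom g : WithZero G') :=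
  rfl

@[simp] lemma Hom.map_one (f : Hom T T') : f.map 1 = 1 := _root_.map_one (WithZero.map' f.toMonoidHom)

@[simp] lemma Hom.map_mul (f : Hom T T') (a b : WithZero G) : f.map (a * b) = f.map a * f.map b :=
  _root_.map_mul (WithZero.map' f.toMonoidHom) a b

@[simp] lemma Hom.map_eq_zero_iff (f : Hom T T') {a : WithZero G} : f.map a = 0 ↔ a = 0 := by
  induction a with
  | zero => simp
  | coe g => simp

lemma Hom.map_div (f : Hom T T') (a b : WithZero G) : f.map (a / b) = f.map a / f.map b :=
  _root_.map_div₀ (WithZero.map' f.toMonoidHom) a b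

lemma Hom.map_pow (f : Hom T T') (a : WithZero G) (n : ℕ) : f.map (a ^ n) = f.map a ^ n :=
  _root_.map_pow (WithZero.map' f.toMonoidHom) a n

lemma Hom.mapDomain_toSum (f : Hom T T') (a : WithZero G) :
    MonoidAlgebra.mapDomain f.toMonoidHom (toSum a) = toSum (f.map a) := by
  induction a with
  | zero => simp
  | coe g => simp [MonoidAlgebra.of]

lemma Hom.mapDomain_sum_toSum (f : Hom T T') {ι : Type*} (s : Finset ι) (a : ι → WithZero G) :
    MonoidAlgebra.mapDomain f.toMonoidHom (∑ i ∈ s, toSum (a i)) =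
      ∑ i ∈ s, toSum (f.map (a i)) := by
  classical
  induction s using Finset.induction_on with
  | empty => simp
  | insert i s hi ih =>
    rw [Finset.sum_insert hi, Finset.sum_insert hi, MonoidAlgebra.mapDomain_add, ih,
      f.mapDomain_toSum]

lemma Hom.sum_mem_null (f : Hom T T') {ι : Type*} (s : Finset ι) {a : ι → WithZero G}
    (h : ∑ i ∈ s, toSum (a i) ∈ T.null) : ∑ i ∈ s, toSum (f.map (a i)) ∈ T'.null :=
  f.mapDomain_sum_toSum s a ▸ f.map_null _ h

lemma Hom.sum_add_mem_null (f : Hom T T') {ι : Type*} (s : Finset ι) {a : ι → WithZero G}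
    {b : WithZero G} (h : ∑ i ∈ s, toSum (a i) + toSum b ∈ T.null) :
    ∑ i ∈ s, toSum (f.map (a i)) + toSum (f.map b) ∈ T'.null := by
  have := f.map_null _ h
  rwa [MonoidAlgebra.mapDomain_add, f.mapDomain_sum_toSum, f.mapDomain_toSum] at this

@[simp] lemma Hom.map_negOne (f : Hom T T') : f.map T.negOne = T'.negOne := by
  have h := f.sum_add_mem_null (Finset.univ : Finset Unit) (a := fun _ => 1) (b := T.negOne)
    (by simpa using T.one_add_negOne)
  exact T'.eq_negOne_of_one_add (by simpa using h)

@[simp] lemma Involution.map_map (τ : Involution T) (a : WithZero G) : τ.map (τ.map a) = a := by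
  induction a with
  | zero => simp
  | coe g => simp [τ.involutive g]

/-! ### Supports and scaling -/

lemma mem_supp {G₀ : Type*} {X : E → WithZero G₀} {e : E} : e ∈ supp X ↔ X e ≠ 0 := Iff.rfl

lemma notMem_supp {G₀ : Type*} {X : E → WithZero G₀} {e : E} : e ∉ supp X ↔ X e = 0 := not_not

@[simp] lemma supp_smul {c : WithZero G} (hc : c ≠ 0) (X : E → WithZero G) :
    supp (fun e => c * X e) = supp X := by
  ext e; simp [mem_supp, hc]

@[simp] lemma supp_map (f : Hom T T') (X : E → WithZero G) :
    supp (fun e => f.map (X e)) = supp X := by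
  ext e; simp [mem_supp]

lemma supp_eq_empty {G₀ : Type*} {X : E → WithZero G₀} : supp X = ∅ ↔ X = 0 := by
  simp [Set.eq_empty_iff_forall_notMem, notMem_supp, funext_iff]

/-! ### The bilinear pairing -/

variable [Fintype E]

/-- Two vectors are perpendicular for the bilinear (unconjugated) pairing. -/
def Perp (T : Tract G) (W X : E → WithZero G) : Prop := ∑ e, toSum (W e * X e) ∈ T.null

lemma Perp.symm {W X : E → WithZero G} (h : Perp T W X) : Perp T X W := by
  simpa only [Perp, mul_comm] using h

lemma orthogonal_iff_perp_right (τ : Involution T) {W X : E → WithZero G} :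
    Orthogonal τ W X ↔ Perp T W (fun e => τ.map (X e)) := Iff.rfl

/-- Applying `τ` to the whole null sum moves the conjugation to the other factor, because `τ` is an
involution. This reduces the conjugated pairing to the bilinear one. -/
lemma orthogonal_iff_perp_left (τ : Involution T) {W X : E → WithZero G} :
    Orthogonal τ W X ↔ Perp T (fun e => τ.map (W e)) X := by
  constructor <;> intro h <;> simpa [Perp, Orthogonal, dot] using τ.sum_mem_null _ h

lemma Orthogonal.symm {τ : Involution T} {W X : E → WithZero G} (h : Orthogonal τ W X) :
    Orthogonal τ X W :=
  ((orthogonal_iff_perp_left τ).1 h).symm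

lemma Orthogonal.map {τ : Involution T} {τ' : Involution T'} (f : Hom T T')
    (hf : ∀ x : WithZero G, f.map (τ.map x) = τ'.map (f.map x)) {W X : E → WithZero G}
    (h : Orthogonal τ W X) :
    Orthogonal τ' (fun e => f.map (W e)) (fun e => f.map (X e)) := by
  have := f.sum_mem_null _ h
  simpa only [Orthogonal, dot, f.map_mul, hf] using this

lemma perp_smul_left {c : WithZero G} (hc : c ≠ 0) {W X : E → WithZero G} :
    Perp T (fun e => c * W e) X ↔ Perp T W X := by
  simp only [Perp, mul_assoc, toSum_mul c, ← Finset.mul_sum]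
  exact T.null_smul_iff hc

lemma perp_smul_right {c : WithZero G} (hc : c ≠ 0) {W X : E → WithZero G} :
    Perp T W (fun e => c * X e) ↔ Perp T W X :=
  ⟨fun h => ((perp_smul_left hc).1 h.symm).symm, fun h => ((perp_smul_left hc).2 h.symm).symm⟩

lemma orthogonal_smul {τ : Involution T} {c d : WithZero G} (hc : c ≠ 0) (hd : d ≠ 0)
    {W X : E → WithZero G} :
    Orthogonal τ (fun e => c * W e) (fun e => d * X e) ↔ Orthogonal τ W X := by
  rw [orthogonal_iff_perp_left, orthogonal_iff_perp_left, perp_smul_right hd]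
  simp only [Hom.map_mul]
  exact perp_smul_left (by simpa using hc)

lemma perp_iff_sum_of_injective {ι : Type*} [Fintype ι] (p : ι → E) (hp : Function.Injective p)
    {W X : E → WithZero G} (h : supp W ∩ supp X ⊆ Set.range p) :
    Perp T W X ↔ ∑ i, toSum (W (p i) * X (p i)) ∈ T.null := by
  rw [Perp, Fintype.sum_of_injective p hp (fun i => toSum (W (p i) * X (p i)))
    (fun e => toSum (W e * X e)) ?_ (fun _ => rfl)]
  intro e he
  have : W e * X e = 0 := by
    by_contra h0
    exact he (h ⟨left_ne_zero_of_mul h0, right_ne_zero_of_mul h0⟩)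
  rw [this, toSum_zero]

lemma perp_iff_of_inter_subset_pair {W X : E → WithZero G} {e f : E} (hef : e ≠ f)
    (h : supp W ∩ supp X ⊆ {e, f}) :
    Perp T W X ↔ W e * X e = T.negOne * (W f * X f) := by
  rw [perp_iff_sum_of_injective ![e, f] (by
    intro i j; fin_cases i <;> fin_cases j <;> simp [hef, hef.symm]) (by simpa [Set.pair_comm] using h),
    ← T.add_mem_null_iff]
  simp

end Tract

/-! ### Matroids from circuits, and nullity -/

namespace Matroid

variable {E : Type*} [Finite E]

/-- The augmentation property of sets containing no member of a family satisfying circuit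
elimination. -/
lemma exists_insert_of_elimination {S : Set (Set E)}
    (elim : ∀ A ∈ S, ∀ B ∈ S, A ≠ B → ∀ e ∈ A ∩ B, ∃ Z ∈ S, Z ⊆ (A ∪ B) \ {e})
    {I J : Set E} (hI : ∀ C ∈ S, ¬ C ⊆ I) (hJ : ∀ C ∈ S, ¬ C ⊆ J) (hIJ : I.ncard < J.ncard) :
    ∃ e ∈ J, e ∉ I ∧ ∀ C ∈ S, ¬ C ⊆ insert e I := by
  induction hn : (I \ J).ncard generalizing J with
  | zero =>
    have hsub : I ⊆ J := by
      rw [← Set.sdiff_eq_empty]; exact (Set.ncard_eq_zero (Set.toFinite _)).1 hn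
    obtain ⟨e, heJ, heI⟩ := Set.exists_mem_notMem_of_ncard_lt_ncard hIJ
    exact ⟨e, heJ, heI, fun C hC hCI => hJ C hC (hCI.trans (Set.insert_subset heJ hsub))⟩
  | succ n ih =>
    obtain ⟨x, hxI, hxJ⟩ : (I \ J).Nonempty := by
      rw [← Set.ncard_pos (Set.toFinite _)]; omega
    -- Bring `x` into `J`. If this creates a circuit `K`, drop some `y ∈ K \ I`: any other circuit
    -- of `insert x J` also contains `x`, and eliminating `x` against `K` would leave a circuit
    -- inside `J`.
    by_cases hK : ∃ K ∈ S, K ⊆ insert x J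
    · obtain ⟨K, hKS, hKJ⟩ := hK
      obtain ⟨y, hyK, hyI⟩ := Set.not_subset.1 (hI K hKS)
      have hyx : y ≠ x := fun h => hyI (h ▸ hxI)
      have hyJ : y ∈ J := (hKJ hyK).resolve_left hyx
      have hxmem : ∀ C ∈ S, C ⊆ insert x J → x ∈ C := fun C hC hCJ => by
        by_contra hx
        exact hJ C hC fun z hz => (hCJ hz).resolve_left fun h => hx (h ▸ hz)
      obtain ⟨e, he, heI, h⟩ := ih (J := insert x (J \ {y})) (by
        intro C hC hCJ
        have hCJ' : C ⊆ insert x J := hCJ.trans (Set.insert_subset_insert Set.sdiff_subset)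
        have hne : C ≠ K := by
          rintro rfl
          rcases hCJ hyK with h | h
          · exact hyx h
          · exact h.2 rfl
        obtain ⟨Z, hZ, hZs⟩ := elim C hC K hKS hne x ⟨hxmem C hC hCJ', hxmem K hKS hKJ⟩
        refine hJ Z hZ fun z hz => ?_
        have hz' := hZs hz
        exact ((Set.union_subset hCJ' hKJ) hz'.1).resolve_left hz'.2)
        (by rwa [Set.ncard_exchange hxJ hyJ])
        (by
          have : I \ J = insert x (I \ insert x (J \ {y})) := by
            ext z
            simp only [Set.mem_sdiff, Set.mem_insert_iff, Set.mem_singleton_iff]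
            constructor
            · rintro ⟨h1, h2⟩; by_cases z = x <;> simp_all
            · rintro (rfl | ⟨h1, h2⟩)
              · exact ⟨hxI, hxJ⟩
              · refine ⟨h1, fun h3 => h2 (Or.inr ⟨h3, ?_⟩)⟩
                rintro rfl; exact hyI h1
          rw [this, Set.ncard_insert_of_notMem (by simp) (Set.toFinite _)] at hn
          omega)
      refine ⟨e, ?_, heI, h⟩
      rcases he with rfl | he
      · exact absurd hxI heI
      · exact he.1
    · push Not at hK
      obtain ⟨e, he, heI, h⟩ := ih (J := insert x J) hK
        (by rw [Set.ncard_insert_of_notMem hxJ (Set.toFinite _)]; omega)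
        (by
          have : I \ J = insert x (I \ insert x J) := by
            ext z
            simp only [Set.mem_sdiff, Set.mem_insert_iff]
            constructor
            · rintro ⟨h1, h2⟩; by_cases z = x <;> simp_all
            · rintro (rfl | ⟨h1, h2⟩)
              · exact ⟨hxI, hxJ⟩
              · exact ⟨h1, fun h3 => h2 (Or.inr h3)⟩
          rw [this, Set.ncard_insert_of_notMem (by simp) (Set.toFinite _)] at hn
          omega)
      refine ⟨e, ?_, heI, h⟩
      rcases he with rfl | he
      · exact absurd hxI heI
      · exact he

/-- A family of sets satisfying the circuit axioms is the set of circuits of a matroid. -/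
lemma exists_of_circuit_axioms {S : Set (Set E)} (hempty : ∅ ∉ S)
    (anti : ∀ A ∈ S, ∀ B ∈ S, A ⊆ B → A = B)
    (elim : ∀ A ∈ S, ∀ B ∈ S, A ≠ B → ∀ e ∈ A ∩ B, ∃ Z ∈ S, Z ⊆ (A ∪ B) \ {e}) :
    ∃ M : Matroid E, M.E = Set.univ ∧ ∀ A, M.IsCircuit A ↔ A ∈ S := by
  let M : Matroid E := (IndepMatroid.ofFinite (Set.toFinite (Set.univ : Set E))
    (fun I => ∀ C ∈ S, ¬ C ⊆ I)
    (fun C hC h => hempty (Set.subset_empty_iff.1 h ▸ hC))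
    (fun I J hJ hIJ C hC hCI => hJ C hC (hCI.trans hIJ))
    (fun I J hI hJ hIJ => exists_insert_of_elimination elim hI hJ hIJ)
    (fun _ _ => Set.subset_univ _)).matroid
  have hE : M.E = Set.univ := rfl
  have hdep : ∀ A, M.Dep A ↔ ∃ C ∈ S, C ⊆ A := fun A => by
    rw [Matroid.Dep, hE, and_iff_left (Set.subset_univ _)]
    simp [M]
  refine ⟨M, hE, fun A => ?_⟩
  rw [isCircuit_iff, hdep]
  constructor
  · rintro ⟨⟨C, hC, hCA⟩, h⟩
    rwa [← h ((hdep C).2 ⟨C, hC, subset_rfl⟩) hCA]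
  · intro hA
    refine ⟨⟨A, hA, subset_rfl⟩, fun D hD hDA => ?_⟩
    obtain ⟨C, hC, hCD⟩ := (hdep D).1 hD
    have := anti C hC A hA (hCD.trans hDA)
    exact hDA.antisymm (this ▸ hCD)

variable {M : Matroid E}

/-- The nullity `|X| - r(X)` of a set. -/
noncomputable def nullity (M : Matroid E) (X : Set E) : ℕ := X.ncard - (M.eRk X).toNat

lemma eRk_eq_coe_toNat (M : Matroid E) (X : Set E) : ((M.eRk X).toNat : ℕ∞) = M.eRk X :=
  ENat.natCast_toNat (ne_top_of_le_ne_top (Set.encard_ne_top_iff.2 (Set.toFinite X))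
    (M.eRk_le_encard X))

lemma toNat_eRk_le_ncard (M : Matroid E) (X : Set E) : (M.eRk X).toNat ≤ X.ncard := by
  have := M.eRk_le_encard X
  rw [← eRk_eq_coe_toNat, ← (Set.toFinite X).cast_ncard_eq] at this
  exact_mod_cast this

lemma nullity_add (M : Matroid E) (X : Set E) : M.nullity X + (M.eRk X).toNat = X.ncard :=
  Nat.sub_add_cancel (M.toNat_eRk_le_ncard X)

lemma nullity_mono (M : Matroid E) {X Y : Set E} (h : X ⊆ Y) : M.nullity X ≤ M.nullity Y := by
  have h1 := M.eRk_union_le_encard_add_eRk (Y \ X) X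
  rw [Set.sdiff_union_of_subset h, ← eRk_eq_coe_toNat M X, ← eRk_eq_coe_toNat M Y,
    ← (Set.toFinite (Y \ X)).cast_ncard_eq] at h1
  have h1' : (M.eRk Y).toNat ≤ (Y \ X).ncard + (M.eRk X).toNat := by exact_mod_cast h1
  have h2 := Set.ncard_sdiff_add_ncard_of_subset h
  have h3 := M.nullity_add X
  have h4 := M.nullity_add Y
  omega

lemma nullity_eq_zero_iff {X : Set E} : M.nullity X = 0 ↔ M.Indep X := by
  have h := M.nullity_add X
  rw [indep_iff_eRk_eq_encard_of_finite (Set.toFinite X), ← eRk_eq_coe_toNat,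
    ← (Set.toFinite X).cast_ncard_eq, Nat.cast_inj]
  omega

lemma nullity_eq_of_subset_closure {X Y : Set E} (h : X ⊆ Y) (hY : Y ⊆ M.closure X) :
    M.nullity Y = M.nullity X + (Y \ X).ncard := by
  have h1 : M.eRk Y = M.eRk X :=
    le_antisymm ((M.eRk_mono hY).trans_eq (M.eRk_closure_eq X)) (M.eRk_mono h)
  have h2 := Set.ncard_sdiff_add_ncard_of_subset h
  have h3 := M.nullity_add X
  have h4 := M.nullity_add Y
  rw [h1] at h4
  omega

lemma nullity_le_of_indep_subset {I X : Set E} (hI : M.Indep I) (h : I ⊆ X) :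
    M.nullity X ≤ (X \ I).ncard := by
  have h1 := hI.encard_le_eRk_of_subset h
  rw [← eRk_eq_coe_toNat, ← (Set.toFinite I).cast_ncard_eq, Nat.cast_le] at h1
  have h2 := Set.ncard_sdiff_add_ncard_of_subset h
  have h4 := M.nullity_add X
  omega

/-- Deleting an element of a circuit decreases the nullity by one. -/
lemma nullity_sdiff_singleton {C X : Set E} (hC : M.IsCircuit C) (hCX : C ⊆ X) {e : E}
    (he : e ∈ C) (hE : M.E = Set.univ) : M.nullity (X \ {e}) + 1 = M.nullity X := by
  have h1 : X ⊆ M.closure (X \ {e}) := by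
    intro x hx
    by_cases hxe : x = e
    · subst hxe
      exact M.closure_subset_closure (Set.sdiff_subset_sdiff_left hCX)
        (hC.mem_closure_sdiff_singleton_of_mem he)
    · exact M.mem_closure_of_mem' ⟨hx, hxe⟩ (hE ▸ Set.mem_univ x)
  rw [nullity_eq_of_subset_closure Set.sdiff_subset h1,
    Set.sdiff_sdiff_cancel_left (Set.singleton_subset_iff.2 (hCX he)), Set.ncard_singleton]

lemma nullity_lt_of_exists_circuit (hE : M.E = Set.univ) {C X Y : Set E} (hXY : X ⊆ Y)
    (hC : M.IsCircuit C) (hCY : C ⊆ Y) (hCX : ¬ C ⊆ X) : M.nullity X < M.nullity Y := by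
  obtain ⟨e, heC, heX⟩ := Set.not_subset.1 hCX
  have h1 := nullity_sdiff_singleton hC hCY heC hE
  have h2 := M.nullity_mono (X := X) (Y := Y \ {e}) (Set.subset_sdiff_singleton hXY heX)
  omega

end Matroid

/-! ### Heights and modular families in terms of nullity -/

namespace Tract

open Matroid

variable {E : Type*} {M : Matroid E}

/-- In the lattice of unions of circuits the height is the nullity. -/
lemma height_unionLattice [Finite E] (hE : M.E = Set.univ) {S : Set (Set E)}
    (hS : ∀ A, M.IsCircuit A ↔ A ∈ S) (A : unionLattice S) :
    Order.height A = M.nullity A.1 := by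
  -- Nullity is strictly increasing on the lattice, which bounds the height from above.
  have hlt : ∀ A B : unionLattice S, A < B → M.nullity A.1 < M.nullity B.1 := by
    rintro ⟨A, hA⟩ ⟨B, R, hR, rfl⟩ hAB
    have hAB' : A ⊂ ⋃₀ R := hAB
    obtain ⟨x, ⟨C, hCR, hxC⟩, hxA⟩ := Set.exists_of_ssubset hAB'
    exact nullity_lt_of_exists_circuit hE hAB'.1 ((hS C).2 (hR hCR))
      (Set.subset_sUnion_of_mem hCR) fun h => hxA (h hxC)
  apply le_antisymm
  · suffices ∀ n : ℕ, ∀ A : unionLattice S, M.nullity A.1 ≤ n → Order.height A ≤ n from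
      this _ A le_rfl
    intro n
    induction n with
    | zero =>
      intro A hA
      rw [Order.height_le_coe_iff]
      intro B hB
      have := hlt B A hB
      omega
    | succ n ih =>
      intro A hA
      rw [Order.height_le_coe_iff]
      intro B hB
      have := hlt B A hB
      refine (ih B (by omega)).trans_lt ?_
      exact_mod_cast Nat.lt_succ_self n
  · suffices ∀ n : ℕ, ∀ A : unionLattice S, M.nullity A.1 = n → n ≤ Order.height A from
      this _ A rfl
    intro n
    induction n with
    | zero => intro A _; simp
    | succ n ih =>
      intro A hA
      have hdep : ¬ M.Indep A.1 := fun h => by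
        rw [nullity_eq_zero_iff.2 h] at hA; omega
      obtain ⟨C, hCA, hC⟩ := ((not_indep_iff (hE ▸ Set.subset_univ _)).1 hdep).exists_isCircuit_subset
      obtain ⟨e, he⟩ := hC.nonempty
      have h1 := nullity_sdiff_singleton hC hCA he hE
      -- Elements of `A \ {e}` on no circuit inside it do not affect nullity, so the union of those
      -- circuits has the same nullity as `A \ {e}`, namely one less than `A`.
      let R : Set (Set E) := {C ∈ S | C ⊆ A.1 \ {e}}
      let B : unionLattice S := ⟨⋃₀ R, R, fun C hC => hC.1, rfl⟩
      have hBsub : B.1 ⊆ A.1 \ {e} := Set.sUnion_subset fun C hC => hC.2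
      have hBA : B < A := by
        refine lt_of_le_of_ne (show B.1 ⊆ A.1 from hBsub.trans Set.sdiff_subset) fun h => ?_
        have : e ∈ B.1 := by rw [h]; exact hCA he
        exact (hBsub this).2 rfl
      have hB : M.nullity B.1 = n := by
        obtain ⟨I, hI⟩ := M.exists_isBasis B.1 (hE ▸ Set.subset_univ _)
        have hind : M.Indep (I ∪ ((A.1 \ {e}) \ B.1)) := by
          rw [indep_iff_forall_subset_not_isCircuit (hE ▸ Set.subset_univ _)]
          intro D hD hDc
          have hDA : D ⊆ A.1 \ {e} := hD.trans
            (Set.union_subset (hI.subset.trans hBsub) Set.sdiff_subset)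
          have hDB : D ⊆ B.1 := Set.subset_sUnion_of_mem (show D ∈ R from ⟨(hS D).1 hDc, hDA⟩)
          refine hDc.not_indep (hI.indep.subset fun x hx => ?_)
          exact (hD hx).resolve_right fun h => h.2 (hDB hx)
        have h2 := nullity_le_of_indep_subset hind
          (Set.union_subset (hI.subset.trans hBsub) Set.sdiff_subset)
        have h3 := nullity_eq_of_subset_closure hI.subset hI.subset_closure
        rw [nullity_eq_zero_iff.2 hI.indep] at h3
        have h4 : ((A.1 \ {e}) \ (I ∪ ((A.1 \ {e}) \ B.1))) ⊆ B.1 \ I := by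
          intro x hx
          simp only [Set.mem_sdiff, Set.mem_union, not_or, not_and, not_not] at hx ⊢
          exact ⟨hx.2.2 hx.1, hx.2.1⟩
        have h5 := Set.ncard_le_ncard h4 (Set.toFinite _)
        have h6 := M.nullity_mono hBsub
        omega
      have := Order.height_add_one_le hBA
      refine le_trans ?_ this
      push_cast
      gcongr
      exact ih B hB

/-- A family of circuits is modular if and only if its union has nullity `n`. -/
lemma isModularFamily_iff [Finite E] (hE : M.E = Set.univ) {S : Set (Set E)}
    (hS : ∀ A, M.IsCircuit A ↔ A ∈ S) {n : ℕ} {A : Fin n → Set E} :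
    IsModularFamily S A ↔ (∀ i, M.IsCircuit (A i)) ∧ M.nullity (⋃ i, A i) = n := by
  simp only [IsModularFamily, hS]
  refine and_congr_right fun h => ?_
  have hmem : (⋃ i, A i) ∈ unionLattice S :=
    ⟨Set.range A, by rintro _ ⟨i, rfl⟩; exact h i, (Set.sUnion_range A).symm⟩
  constructor
  · rintro ⟨_, h2⟩
    rw [height_unionLattice hE hS] at h2
    exact_mod_cast h2
  · intro h2
    exact ⟨hmem, by rw [height_unionLattice hE hS]; exact_mod_cast h2⟩

/-- Let `U` be the union of the circuits `A 0, …, A k`, let `g` be an element of `A 0` in no other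
`A i`, and let `e i` be an element of `A i.succ` in no other `A j.succ`. Then `U` is spanned by
`U \ {g, e 0, …, e (k - 1)}`. -/
lemma subset_closure_sdiff_transversal (hE : M.E = Set.univ) {k : ℕ} {A : Fin (k + 1) → Set E}
    (hA : ∀ i, M.IsCircuit (A i)) {g : E} (hg : g ∈ A 0) (hg' : ∀ i : Fin k, g ∉ A i.succ)
    {e : Fin k → E} (he : ∀ i, e i ∈ A i.succ) (he' : ∀ i j : Fin k, j ≠ i → e i ∉ A j.succ) :
    (⋃ i, A i) ⊆ M.closure ((⋃ i, A i) \ insert g (Set.range e)) := by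
  set U := ⋃ i, A i with hU
  have hAU : ∀ i, A i ⊆ U := Set.subset_iUnion A
  have hmem : ∀ x ∈ U \ insert g (Set.range e), x ∈ M.closure (U \ insert g (Set.range e)) :=
    fun x hx => M.mem_closure_of_mem' hx (hE ▸ Set.mem_univ x)
  have he2 : ∀ i, e i ∈ M.closure (U \ insert g (Set.range e)) := by
    intro i
    refine M.closure_subset_closure ?_ ((hA i.succ).mem_closure_sdiff_singleton_of_mem (he i))
    rintro x ⟨hx, hxe⟩
    refine ⟨hAU _ hx, ?_⟩
    rintro (rfl | ⟨j, rfl⟩)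
    · exact hg' i hx
    · exact he' j i (fun h => hxe (by rw [h]; rfl)) hx
  have hg2 : g ∈ M.closure (U \ insert g (Set.range e)) := by
    refine M.closure_subset_closure_of_subset_closure ?_
      ((hA 0).mem_closure_sdiff_singleton_of_mem hg)
    rintro x ⟨hx, hxg⟩
    by_cases hxe : x ∈ Set.range e
    · obtain ⟨i, rfl⟩ := hxe
      exact he2 i
    · exact hmem x ⟨hAU _ hx, fun h => h.elim hxg hxe⟩
  intro x hx
  by_cases hxg : x = g
  · exact hxg ▸ hg2
  by_cases hxe : x ∈ Set.range e
  · obtain ⟨i, rfl⟩ := hxe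
    exact he2 i
  · exact hmem x ⟨hx, fun h => h.elim hxg hxe⟩

/-- Deleting these `k + 1` distinct elements keeps the span, so each deletion costs exactly one unit
of nullity. When the family is modular, what remains is therefore independent. -/
lemma nullity_iUnion_eq [Finite E] (hE : M.E = Set.univ) {k : ℕ} {A : Fin (k + 1) → Set E}
    (hA : ∀ i, M.IsCircuit (A i)) {g : E} (hg : g ∈ A 0) (hg' : ∀ i : Fin k, g ∉ A i.succ)
    {e : Fin k → E} (he : ∀ i, e i ∈ A i.succ) (he' : ∀ i j : Fin k, j ≠ i → e i ∉ A j.succ) :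
    M.nullity (⋃ i, A i) = M.nullity ((⋃ i, A i) \ insert g (Set.range e)) + (k + 1) := by
  rw [nullity_eq_of_subset_closure Set.sdiff_subset
    (subset_closure_sdiff_transversal hE hA hg hg' he he'), Set.sdiff_sdiff_cancel_left]
  · have hinj : Function.Injective e := fun i j hij => by
      by_contra hne
      exact he' i j (Ne.symm hne) (hij ▸ he j)
    rw [Set.ncard_insert_of_notMem _ (Set.toFinite _), ← Set.image_univ,
      Set.ncard_image_of_injective _ hinj, Set.ncard_univ, Nat.card_fin]
    rintro ⟨i, rfl⟩
    exact hg' i (he i)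
  · refine Set.insert_subset (Set.mem_iUnion_of_mem 0 hg) ?_
    rintro _ ⟨i, rfl⟩
    exact Set.mem_iUnion_of_mem i.succ (he i)

/-- Two circuits whose union has nullity at most two form a modular pair. -/
lemma isModularPair_of_nullity_le [Finite E] (hE : M.E = Set.univ) {S : Set (Set E)}
    (hS : ∀ A, M.IsCircuit A ↔ A ∈ S) {A B : Set E} (hA : A ∈ S) (hB : B ∈ S) (hAB : A ≠ B)
    (h : M.nullity (A ∪ B) ≤ 2) : IsModularPair S A B := by
  refine ⟨hA, hB, hAB, fun A' hA' B' hB' hne hss => ?_⟩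
  have hA'c := (hS A').2 hA'
  have hB'c := (hS B').2 hB'
  -- Nullity would increase strictly along `∅ ⊂ A' ⊂ A' ∪ B' ⊂ A ∪ B`, hence reach three.
  have h1 : M.nullity A' < M.nullity (A' ∪ B') :=
    nullity_lt_of_exists_circuit hE Set.subset_union_left hB'c Set.subset_union_right
      fun h => hne (hB'c.eq_of_subset_isCircuit hA'c h).symm
  have h2 : M.nullity ∅ < M.nullity A' :=
    nullity_lt_of_exists_circuit hE (Set.empty_subset _) hA'c subset_rfl
      fun h => hA'c.nonempty.ne_empty (Set.subset_empty_iff.1 h)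
  have h3 : M.nullity (A' ∪ B') < M.nullity (A ∪ B) := by
    by_cases hc : A ⊆ A' ∪ B'
    · exact nullity_lt_of_exists_circuit hE hss.1 ((hS B).2 hB) Set.subset_union_right
        fun h => hss.2 (Set.union_subset hc h)
    · exact nullity_lt_of_exists_circuit hE hss.1 ((hS A).2 hA) Set.subset_union_left hc
  omega

end Tract

namespace Tract

open Matroid

variable {G : Type*} [CommGroup G] {E : Type*} {T : Tract G}

/-! ### Elimination for families of bounded size -/

/-- The sizes of families for which elimination is required: weak matroids only satisfy
elimination between two circuits. -/
def Flavour.Allows : Flavour → ℕ → Prop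
  | .weak, n => n ≤ 1
  | .strong, _ => True

lemma Flavour.Allows.mono {k : Flavour} {m n : ℕ} (hn : k.Allows n) (h : m ≤ n) : k.Allows m := by
  cases k with
  | weak => exact h.trans hn
  | strong => trivial

lemma Flavour.allows_one (k : Flavour) : k.Allows 1 := by
  cases k with
  | weak => exact le_rfl
  | strong => trivial

/-- Strong modular elimination for families of `k + 1` vectors. -/
def EliminationAt (T : Tract G) (C : Set (E → WithZero G)) (k : ℕ) : Prop :=
  ∀ (X : Fin (k + 1) → E → WithZero G) (e : Fin k → E),
    (∀ i, X i ∈ C) →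
    IsModularFamily (supp '' C) (fun i => supp (X i)) →
    ¬ (supp (X 0) ⊆ ⋃ i : Fin k, supp (X i.succ)) →
    (∀ i j : Fin k, j ≠ i → e i ∉ supp (X j.succ)) →
    (∀ i : Fin k, X 0 (e i) = T.negOne * X i.succ (e i) ∧ X 0 (e i) ≠ 0) →
    ∃ Z ∈ C, (∀ i, Z (e i) = 0) ∧
      ∀ f, (∑ i, toSum (X i f)) + toSum (T.negOne * Z f) ∈ T.null

/-- If the sum of two elements and the negative of a third is null and the second is zero, then
the other two agree. -/
lemma eq_of_add_mem_null {a b c : WithZero G}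
    (h : toSum a + toSum b + toSum (T.negOne * c) ∈ T.null) (hb : b = 0) : c = a := by
  rw [hb, toSum_zero, add_zero, T.add_negOne_mem_null_iff] at h
  exact h.symm

lemma eq_of_add_mem_null' {a b c : WithZero G}
    (h : toSum a + toSum b + toSum (T.negOne * c) ∈ T.null) (ha : a = 0) : c = b := by
  rw [add_comm (toSum a)] at h
  exact eq_of_add_mem_null h ha

/-- The argument uses only the order, since no underlying matroid is available yet. Three strict
steps ending at `A ∪ B` would produce two distinct members whose union is properly smaller, while `∅
< A < A ∪ B` always gives two. -/
lemma height_union_of_isModularPair {S : Set (Set E)} (hempty : ∅ ∉ S)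
    (anti : ∀ A ∈ S, ∀ B ∈ S, A ⊆ B → A = B) {A B : Set E} (h : IsModularPair S A B)
    (hmem : A ∪ B ∈ unionLattice S) : Order.height (⟨A ∪ B, hmem⟩ : unionLattice S) = 2 := by
  have key : ∀ x y : unionLattice S, x < y → ∃ K ∈ S, K ⊆ y.1 ∧ ¬ K ⊆ x.1 := by
    rintro ⟨x, hx⟩ ⟨y, R, hR, rfl⟩ hxy
    have hxy' : x ⊂ ⋃₀ R := hxy
    obtain ⟨z, ⟨K, hK, hzK⟩, hzx⟩ := Set.exists_of_ssubset hxy'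
    exact ⟨K, hR hK, Set.subset_sUnion_of_mem hK, fun h => hzx (h hzK)⟩
  apply le_antisymm
  · rw [← Nat.cast_ofNat, Order.height_le_coe_iff]
    intro y hy
    refine lt_of_le_of_lt (b := ((1 : ℕ) : ℕ∞)) ?_ (by exact_mod_cast Nat.lt_succ_self 1)
    rw [Order.height_le_coe_iff]
    intro z hz
    refine lt_of_le_of_lt (b := ((0 : ℕ) : ℕ∞)) ?_ (by exact_mod_cast Nat.lt_succ_self 0)
    rw [Order.height_le_coe_iff]
    intro w hw
    obtain ⟨K, hK, hKz, -⟩ := key w z hw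
    obtain ⟨K', hK', hKy, hKz'⟩ := key z y hz
    refine absurd ?_ (h.2.2.2 K hK K' hK' (fun h => hKz' (h ▸ hKz)))
    exact (Set.union_subset (hKz.trans hz.le) hKy).trans_ssubset hy
  · have hA0 : ∅ ∈ unionLattice S := ⟨∅, Set.empty_subset _, by simp⟩
    have hA1 : A ∈ unionLattice S := ⟨{A}, by simpa using h.1, by simp⟩
    have h1 : (⟨∅, hA0⟩ : unionLattice S) < ⟨A, hA1⟩ := by
      refine lt_of_le_of_ne (Set.empty_subset A) fun h' => hempty ?_
      rw [show (∅ : Set E) = A from congrArg Subtype.val h']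
      exact h.1
    have h2 : (⟨A, hA1⟩ : unionLattice S) < ⟨A ∪ B, hmem⟩ := by
      refine lt_of_le_of_ne (Set.subset_union_left : A ⊆ A ∪ B) fun h' => h.2.2.1 ?_
      have hAB : A = A ∪ B := congrArg Subtype.val h'
      exact (anti B h.2.1 A h.1 (by rw [hAB]; exact Set.subset_union_right)).symm
    have h3 := Order.height_add_one_le h1
    have h4 := Order.height_add_one_le h2
    refine le_trans ?_ h4
    rw [← one_add_one_eq_two]
    gcongr
    exact le_trans (by simp) h3

/-- The union of a modular pair has height two, so the pair is a modular family. This gives strong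
matroids their underlying matroid, and it supplies the axiom when a weak matroid is constructed. -/
lemma modularElimination_of_eliminationAt_one {C : Set (E → WithZero G)}
    (zero_notMem : (0 : E → WithZero G) ∉ C)
    (incomparable : ∀ X ∈ C, ∀ Y ∈ C, supp X ⊆ supp Y →
      ∃ α : G, X = fun e => (α : WithZero G) * Y e)
    (h : EliminationAt T C 1) : ModularElimination T C := by
  have anti : ∀ A ∈ supp '' C, ∀ B ∈ supp '' C, A ⊆ B → A = B := by
    rintro _ ⟨X, hX, rfl⟩ _ ⟨Y, hY, rfl⟩ hXY
    obtain ⟨α, rfl⟩ := incomparable X hX Y hY hXY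
    exact supp_smul WithZero.coe_ne_zero Y
  have hempty : ∅ ∉ supp '' C := by
    rintro ⟨X, hX, h0⟩
    exact zero_notMem (supp_eq_empty.1 h0 ▸ hX)
  intro X hX Y hY hXY e he he0
  have hU : (⋃ i : Fin 2, supp (![X, Y] i)) = supp X ∪ supp Y := by
    ext x; simp [Fin.exists_fin_two]
  have hmem : supp X ∪ supp Y ∈ unionLattice (supp '' C) :=
    ⟨{supp X, supp Y}, Set.insert_subset hXY.1 (Set.singleton_subset_iff.2 hXY.2.1), by simp⟩
  obtain ⟨Z, hZ, hZe, hZf⟩ := h ![X, Y] ![e]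
    (by intro i; fin_cases i <;> simp [hX, hY])
    ⟨by intro i; fin_cases i <;> simp [hXY.1, hXY.2.1], by
      simp_rw [hU]
      exact ⟨hmem, height_union_of_isModularPair hempty anti hXY hmem⟩⟩
    (by
      intro hsub
      exact hXY.2.2.1 (anti _ hXY.1 _ hXY.2.1 (hsub.trans (Set.iUnion_subset fun i => by fin_cases i; rfl))))
    (fun i j hij => absurd (Subsingleton.elim j i) hij)
    (by intro i; fin_cases i; simpa using ⟨he, he0⟩)
  refine ⟨Z, hZ, by simpa using hZe 0, fun f => by simpa [Fin.sum_univ_two] using hZf f⟩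

/-- Modular elimination implies circuit elimination for the supports. -/
lemma exists_supp_subset_of_modularElimination [Finite E] {C : Set (E → WithZero G)}
    (h : ModularElimination T C)
    (smul_mem : ∀ X ∈ C, ∀ α : G, (fun e => (α : WithZero G) * X e) ∈ C) :
    ∀ A ∈ supp '' C, ∀ B ∈ supp '' C, A ≠ B → ∀ e ∈ A ∩ B,
      ∃ Z ∈ supp '' C, Z ⊆ (A ∪ B) \ {e} := by
  suffices ∀ n : ℕ, ∀ A ∈ supp '' C, ∀ B ∈ supp '' C, (A ∪ B).ncard = n → A ≠ B → ∀ e ∈ A ∩ B,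
      ∃ Z ∈ supp '' C, Z ⊆ (A ∪ B) \ {e} from
    fun A hA B hB => this _ A hA B hB rfl
  intro n
  induction n using Nat.strong_induction_on with
  | _ n ih =>
    intro A hA B hB hn hAB e he
    by_contra hcon
    push Not at hcon
    -- If every circuit inside `A ∪ B` contains `e`, the pair is modular: a pair with smaller union
    -- also meets in `e`, and induction would give a circuit avoiding `e`.
    have hmod : IsModularPair (supp '' C) A B := by
      refine ⟨hA, hB, hAB, fun A' hA' B' hB' hne hss => ?_⟩
      have hmem : ∀ K ∈ supp '' C, K ⊆ A ∪ B → e ∈ K := fun K hK hKs => by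
        by_contra heK
        exact hcon K hK (Set.subset_sdiff_singleton hKs heK)
      obtain ⟨Z, hZ, hZs⟩ := ih _ (hn ▸ Set.ncard_lt_ncard hss (Set.toFinite _)) A' hA' B' hB' rfl
        hne e ⟨hmem A' hA' (Set.subset_union_left.trans hss.1),
          hmem B' hB' (Set.subset_union_right.trans hss.1)⟩
      exact hcon Z hZ (hZs.trans (Set.sdiff_subset_sdiff_left hss.1))
    obtain ⟨X, hX, rfl⟩ := hA
    obtain ⟨Y, hY, rfl⟩ := hB
    obtain ⟨c, hc⟩ := WithZero.ne_zero_iff_exists.1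
      (mul_ne_zero T.negOne_ne_zero (mul_ne_zero he.1 (inv_ne_zero he.2)))
    have hcY : X e = T.negOne * ((c : WithZero G) * Y e) := by
      rw [hc, mul_assoc, negOne_mul_cancel_left, inv_mul_cancel_right₀ he.2]
    obtain ⟨Z, hZ, hZe, hZf⟩ := h X hX _ (smul_mem Y hY c)
      (by rwa [supp_smul WithZero.coe_ne_zero]) e hcY he.1
    refine hcon _ ⟨Z, hZ, rfl⟩ fun f hf => ⟨?_, ?_⟩
    · by_contra hfn
      rw [Set.mem_union, not_or, notMem_supp, notMem_supp] at hfn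
      exact hf ((eq_of_add_mem_null (hZf f) (by rw [hfn.2, mul_zero])).trans hfn.1)
    · rintro rfl
      exact hf hZe

/-! ### Signatures of a matroid -/

/-- A signature of the matroid `M`: for each circuit, one projective class of vectors supported
on that circuit. -/
structure IsSignature (M : Matroid E) (C : Set (E → WithZero G)) : Prop where
  ground_eq : M.E = Set.univ
  isCircuit_iff : ∀ A, M.IsCircuit A ↔ A ∈ supp '' C
  smul_mem : ∀ X ∈ C, ∀ α : G, (fun e => (α : WithZero G) * X e) ∈ C
  incomparable : ∀ X ∈ C, ∀ Y ∈ C, supp X ⊆ supp Y →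
    ∃ α : G, X = fun e => (α : WithZero G) * Y e

namespace IsSignature

variable {M : Matroid E} {C : Set (E → WithZero G)}

lemma isCircuit (hC : IsSignature M C) {X : E → WithZero G} (hX : X ∈ C) :
    M.IsCircuit (supp X) := (hC.isCircuit_iff _).2 ⟨X, hX, rfl⟩

lemma exists_mem (hC : IsSignature M C) {A : Set E} (hA : M.IsCircuit A) : ∃ X ∈ C, supp X = A :=
  (hC.isCircuit_iff _).1 hA

lemma mul_mem (hC : IsSignature M C) {X : E → WithZero G} (hX : X ∈ C) {c : WithZero G}
    (hc : c ≠ 0) : (fun e => c * X e) ∈ C := by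
  obtain ⟨g, rfl⟩ := WithZero.ne_zero_iff_exists.1 hc
  exact hC.smul_mem X hX g

lemma zero_notMem (hC : IsSignature M C) : (0 : E → WithZero G) ∉ C := fun h =>
  (hC.isCircuit h).nonempty.ne_empty (supp_eq_empty.2 rfl)

lemma subset_ground (hC : IsSignature M C) (A : Set E) : A ⊆ M.E :=
  hC.ground_eq ▸ Set.subset_univ A

/-- Two members of a signature supported inside `insert e I`, for `I` independent, are
proportional. -/
lemma eq_smul_of_subset_insert (hC : IsSignature M C) {X Y : E → WithZero G} (hX : X ∈ C)
    (hY : Y ∈ C) {I : Set E} (hI : M.Indep I) {e : E} (hXI : supp X ⊆ insert e I)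
    (hYI : supp Y ⊆ insert e I) : ∃ α : G, X = fun e => (α : WithZero G) * Y e := by
  refine hC.incomparable X hX Y hY ?_
  rw [(hC.isCircuit hX).eq_fundCircuit_of_subset hI hXI,
    (hC.isCircuit hY).eq_fundCircuit_of_subset hI hYI]

lemma eliminationAt_one [Finite E] (hC : IsSignature M C) (h : ModularElimination T C) :
    EliminationAt T C 1 := by
  intro X e hX hmod hsub he hXe
  rw [isModularFamily_iff hC.ground_eq hC.isCircuit_iff] at hmod
  have hU : (⋃ i : Fin 2, supp (X i)) = supp (X 0) ∪ supp (X 1) := by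
    ext x; simp [Fin.exists_fin_two]
  obtain ⟨Z, hZ, hZe, hZf⟩ := h (X 0) (hX 0) (X 1) (hX 1)
    (isModularPair_of_nullity_le hC.ground_eq hC.isCircuit_iff ⟨_, hX 0, rfl⟩ ⟨_, hX 1, rfl⟩
      (fun h => hsub (h.subset.trans (Set.subset_iUnion (fun i : Fin 1 => supp (X i.succ)) 0))) (by rw [← hU, hmod.2]))
    (e 0) (hXe 0).1 (hXe 0).2
  refine ⟨Z, hZ, fun i => by rwa [Subsingleton.elim i 0], fun f => ?_⟩
  simpa [Fin.sum_univ_two] using hZf f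

/-- Modular elimination of `a` between two vectors of a signature, the second of which may be
rescaled. -/
lemma exists_elimination [Finite E] (hC : IsSignature M C) (h : ModularElimination T C)
    {X Y : E → WithZero G} (hX : X ∈ C) (hY : Y ∈ C) (hXY : supp X ≠ supp Y)
    (hnull : M.nullity (supp X ∪ supp Y) ≤ 2) {a : E} (haX : X a ≠ 0) (haY : Y a ≠ 0) :
    ∃ c : WithZero G, c ≠ 0 ∧ X a = T.negOne * (c * Y a) ∧ ∃ Z ∈ C, Z a = 0 ∧
      supp Z ⊆ supp X ∪ supp Y ∧ (∀ f, Y f = 0 → Z f = X f) ∧ (∀ f, X f = 0 → Z f = c * Y f) := by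
  obtain ⟨c, hc⟩ := WithZero.ne_zero_iff_exists.1
    (mul_ne_zero T.negOne_ne_zero (mul_ne_zero haX (inv_ne_zero haY)))
  have hcY : X a = T.negOne * ((c : WithZero G) * Y a) := by
    rw [hc, mul_assoc, negOne_mul_cancel_left, inv_mul_cancel_right₀ haY]
  refine ⟨c, WithZero.coe_ne_zero, hcY, ?_⟩
  obtain ⟨Z, hZ, hZe, hZf⟩ := h X hX _ (hC.smul_mem Y hY c)
    (isModularPair_of_nullity_le hC.ground_eq hC.isCircuit_iff ⟨X, hX, rfl⟩
      ⟨_, hC.smul_mem Y hY c, rfl⟩ (by rwa [supp_smul WithZero.coe_ne_zero])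
      (by rwa [supp_smul WithZero.coe_ne_zero])) a hcY haX
  have h1 : ∀ f, Y f = 0 → Z f = X f := fun f hf =>
    eq_of_add_mem_null (hZf f) (by rw [hf, mul_zero])
  refine ⟨Z, hZ, hZe, fun f hf => ?_, h1, fun f hf => eq_of_add_mem_null' (hZf f) hf⟩
  by_contra hfn
  rw [Set.mem_union, not_or, notMem_supp, notMem_supp] at hfn
  exact hf ((h1 f hfn.2).trans hfn.1)

end IsSignature

/-! ### The underlying matroid -/

lemma FMatroid.modularElimination {k : Flavour} (N : FMatroid k T E) :
    ModularElimination T N.circuits := by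
  cases k with
  | weak => exact N.elimination
  | strong =>
    exact modularElimination_of_eliminationAt_one N.zero_notMem N.incomparable (N.elimination 1)

lemma FMatroid.exists_isSignature [Finite E] {k : Flavour} (N : FMatroid k T E) :
    ∃ M : Matroid E, IsSignature M N.circuits := by
  obtain ⟨M, hE, hM⟩ := exists_of_circuit_axioms (S := supp '' N.circuits)
    (by
      rintro ⟨X, hX, h0⟩
      exact N.zero_notMem (supp_eq_empty.1 h0 ▸ hX))
    (by
      rintro _ ⟨X, hX, rfl⟩ _ ⟨Y, hY, rfl⟩ hXY
      obtain ⟨α, rfl⟩ := N.incomparable X hX Y hY hXY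
      exact supp_smul WithZero.coe_ne_zero Y)
    (exists_supp_subset_of_modularElimination N.modularElimination N.smul_mem)
  exact ⟨M, hE, hM, N.smul_mem, N.incomparable⟩

lemma FMatroid.eliminationAt [Finite E] {k : Flavour} (N : FMatroid k T E) {M : Matroid E}
    (hM : IsSignature M N.circuits) {n : ℕ} (hn : k.Allows n) (hn' : n ≠ 0) :
    EliminationAt T N.circuits n := by
  cases k with
  | weak =>
    have : n = 1 := by
      have : n ≤ 1 := hn
      omega
    exact this ▸ hM.eliminationAt_one N.modularElimination
  | strong => exact N.elimination n

end Tract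

namespace Tract

open Matroid

variable {G : Type*} [CommGroup G] {E : Type*} {T : Tract G} {M : Matroid E}
  {C : Set (E → WithZero G)} {D : Set E}

/-! ### Existence of orthogonal vectors on cocircuits -/

/-- The complement of `D` is a hyperplane: by minimality of `D`, adding any one of its elements
makes the complement spanning. -/
lemma isBase_insert_of_isCocircuit (hD : M.IsCocircuit D) {A : Set E}
    (hA : M.IsBasis A (M.E \ D)) {e : E} (he : e ∈ D) : M.IsBase (insert e A) := by
  have hmin := isCocircuit_iff_minimal_compl_nonspanning.1 hD
  have heE : e ∈ M.E := hD.subset_ground he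
  have h1 : M.Spanning (M.E \ (D \ {e})) := by
    by_contra h
    exact (hmin.le_of_le h Set.sdiff_subset he).2 rfl
  have h2 : M.E \ (D \ {e}) = insert e (M.E \ D) := by
    ext x
    simp only [Set.mem_sdiff, Set.mem_singleton_iff, Set.mem_insert_iff]
    by_cases hx : x = e
    · simp [hx, heE]
    · simp [hx]
  rw [h2] at h1
  have hecl : e ∉ M.closure A := by
    intro h
    rw [hA.closure_eq_closure] at h
    refine hmin.prop ?_
    rw [spanning_iff_closure_eq Set.sdiff_subset, ← closure_insert_eq_of_mem_closure h]
    exact h1.closure_eq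
  exact (hA.insert_isBasis_insert_of_notMem_closure hecl heE).isBase_of_spanning h1

namespace IsSignature

lemma isBasis_compl (hC : IsSignature M C) {X : E → WithZero G} (hX : X ∈ C) {e : E}
    (he : e ∈ supp X ∩ D) : ∃ A, M.IsBasis A (M.E \ D) ∧ supp X \ D ⊆ A := by
  have h1 : M.Indep (supp X \ D) := (hC.isCircuit hX).ssubset_indep
    ⟨Set.sdiff_subset, fun h => (h he.1).2 he.2⟩
  obtain ⟨A, hA, hXA⟩ := h1.subset_isBasis_of_subset
    (Set.sdiff_subset_sdiff_left (hC.subset_ground (supp X)) : supp X \ D ⊆ M.E \ D)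
  exact ⟨A, hA, hXA⟩

/-- A circuit and a cocircuit never meet in a single element. -/
lemma inter_eq_pair (hC : IsSignature M C) (hD : M.IsCocircuit D) {X : E → WithZero G}
    (hX : X ∈ C) {e f : E} (hf : f ∈ supp X ∩ D) (h : supp X ∩ D ⊆ {e, f}) :
    supp X ∩ D = {e, f} := by
  refine h.antisymm ?_
  have he : e ∈ supp X ∩ D := by
    by_contra he
    refine (hC.isCircuit hX).inter_isCocircuit_ne_singleton hD (e := f) ?_
    refine Set.Subset.antisymm (fun x hx => ?_) (Set.singleton_subset_iff.2 hf)
    rcases h hx with rfl | h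
    · exact absurd hx he
    · exact h
  exact Set.insert_subset he (Set.singleton_subset_iff.2 hf)

/-- The fundamental circuit of `f` over the base `insert e A` contains `f`, and `e` is the only
other element of `D` available to it. -/
lemma exists_inter_eq_pair (hC : IsSignature M C) (hD : M.IsCocircuit D) {A : Set E}
    (hA : M.IsBasis A (M.E \ D)) {e f : E} (hef : e ≠ f) (he : e ∈ D) (hf : f ∈ D) :
    ∃ X ∈ C, supp X \ D ⊆ A ∧ supp X ∩ D = {e, f} := by
  have hB := isBase_insert_of_isCocircuit hD hA he
  have hfA : f ∉ A := fun h => (hA.subset h).2 hf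
  have hfB : f ∉ insert e A := fun h => h.elim (fun h => hef h.symm) hfA
  obtain ⟨X, hX, hXs⟩ := hC.exists_mem
    (hB.fundCircuit_isCircuit (hD.subset_ground hf) hfB)
  have hsub : supp X ⊆ insert f (insert e A) := hXs ▸ M.fundCircuit_subset_insert f _
  refine ⟨X, hX, fun x hx => ?_, hC.inter_eq_pair hD hX
    ⟨hXs ▸ M.mem_fundCircuit f _, hf⟩ fun x hx => ?_⟩
  · rcases hsub hx.1 with rfl | rfl | h
    · exact absurd hf hx.2
    · exact absurd he hx.2
    · exact h
  · rcases hsub hx.1 with rfl | rfl | h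
    · exact Or.inr rfl
    · exact Or.inl rfl
    · exact absurd hx.2 (hA.subset h).2

variable [Finite E]

/-- At most two elements are added to a base. This certifies modularity whenever two circuits are
compared over one basis of the hyperplane. -/
lemma nullity_le_two (hD : M.IsCocircuit D) {A : Set E} (hA : M.IsBasis A (M.E \ D)) {e : E}
    (he : e ∈ D) {U : Set E} {p q : E} (hU : U ⊆ insert p (insert q (insert e A))) :
    M.nullity U ≤ 2 := by
  refine (M.nullity_mono hU).trans ((nullity_le_of_indep_subset
    (isBase_insert_of_isCocircuit hD hA he).indep
    ((Set.subset_insert _ _).trans (Set.subset_insert _ _))).trans ?_)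
  refine (Set.ncard_le_ncard (t := {p, q}) ?_ (Set.toFinite _)).trans
    ((Set.ncard_insert_le p {q}).trans (by rw [Set.ncard_singleton]))
  rintro x ⟨rfl | rfl | h, hx⟩
  · exact Or.inl rfl
  · exact Or.inr rfl
  · exact absurd h hx

/-- A vector meeting the cocircuit `D` in `{e, f}` can be moved from one basis of the hyperplane
to another without changing its values at `e` and `f`. -/
lemma exists_move (hC : IsSignature M C) (h : ModularElimination T C) (hD : M.IsCocircuit D)
    {A A' : Set E} (hA : M.IsBasis A (M.E \ D)) (hA' : M.IsBasis A' (M.E \ D))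
    {X : E → WithZero G} (hX : X ∈ C) {e f : E} (hXD : supp X ∩ D = {e, f})
    (hXA : supp X \ D ⊆ A) :
    ∃ Y ∈ C, supp Y \ D ⊆ A' ∧ supp Y ∩ D = {e, f} ∧ Y e = X e ∧ Y f = X f := by
  induction hn : (A \ A').ncard using Nat.strong_induction_on generalizing A X with
  | _ n ih =>
    by_cases hsub : A ⊆ A'
    · exact ⟨X, hX, hXA.trans hsub, hXD, rfl, rfl⟩
    obtain ⟨a, haA, haA'⟩ := Set.not_subset.1 hsub
    have heX : e ∈ supp X ∩ D := hXD ▸ Set.mem_insert _ _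
    have hfX : f ∈ supp X ∩ D := hXD ▸ Or.inr rfl
    obtain ⟨b, ⟨hbA', hbA⟩, hb⟩ := ((isBase_restrict_iff Set.sdiff_subset).2 hA).exchange
      ((isBase_restrict_iff Set.sdiff_subset).2 hA')
      ⟨haA, haA'⟩
    have hA1 : M.IsBasis (insert b (A \ {a})) (M.E \ D) := (isBase_restrict_iff Set.sdiff_subset).1 hb
    have hlt : (insert b (A \ {a}) \ A').ncard < n := by
      rw [← hn]
      refine Set.ncard_lt_ncard ⟨?_, fun hs => ?_⟩ (Set.toFinite _)
      · rintro x ⟨rfl | hx, hx'⟩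
        · exact absurd hbA' hx'
        · exact ⟨hx.1, hx'⟩
      · rcases (hs ⟨haA, haA'⟩).1 with h1 | h1
        · exact hbA (h1 ▸ haA)
        · exact h1.2 rfl
    by_cases haX : X a = 0
    · refine ih _ hlt hA1 hX hXD (fun x hx => Or.inr ⟨hXA hx, ?_⟩) rfl
      rintro rfl
      exact hx.1 haX
    have haD : a ∉ D := (hA.subset haA).2
    have hbcl : b ∈ M.closure A := hA.subset_closure (hA'.subset hbA')
    -- The fundamental circuit of `b` over `A` lies in the hyperplane, so eliminating `a` against it
    -- leaves all values on `D` unchanged.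
    obtain ⟨W, hW, hWs⟩ := hC.exists_mem (hA.indep.fundCircuit_isCircuit hbcl hbA)
    have hWsub : supp W ⊆ insert b A := hWs ▸ M.fundCircuit_subset_insert b A
    have haW : W a ≠ 0 := by
      intro h0
      refine (hC.isCircuit hW).not_indep (hA1.indep.subset fun x hx => ?_)
      rcases hWsub hx with rfl | hxA
      · exact Or.inl rfl
      · refine Or.inr ⟨hxA, ?_⟩
        rintro rfl
        exact hx h0
    have hWD : ∀ x ∈ D, W x = 0 := fun x hx => by
      by_contra h0
      rcases hWsub h0 with rfl | hxA
      · exact (hA'.subset hbA').2 hx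
      · exact (hA.subset hxA).2 hx
    obtain ⟨c, hc, -, Z, hZ, hZa, hZs, hZX, -⟩ := hC.exists_elimination h hX hW
      (fun hs => by
        have : e ∈ supp W := hs ▸ heX.1
        exact this (hWD e heX.2))
      (nullity_le_two (p := b) (q := f) hD hA heX.2 (by
        refine Set.union_subset (fun x hx => ?_) (hWsub.trans ?_)
        · by_cases hxD : x ∈ D
          · have : x ∈ ({e, f} : Set E) := hXD ▸ ⟨hx, hxD⟩
            rcases this with rfl | rfl <;> simp
          · simp [hXA ⟨hx, hxD⟩]
        · exact Set.insert_subset_insert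
            ((Set.subset_insert _ _).trans (Set.subset_insert _ _)))) haX haW
    have hZe : Z e = X e := hZX e (hWD e heX.2)
    have hZf : Z f = X f := hZX f (hWD f hfX.2)
    obtain ⟨Y, hY, hYA, hYD, hYe, hYf⟩ := ih _ hlt hA1 hZ (by
      rw [← hXD]
      refine Set.Subset.antisymm (fun x hx => ?_) (hXD ▸ ?_)
      · refine ⟨?_, hx.2⟩
        rw [mem_supp, ← hZX x (hWD x hx.2)]
        exact hx.1
      · refine Set.insert_subset ⟨?_, heX.2⟩ (Set.singleton_subset_iff.2 ⟨?_, hfX.2⟩)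
        · rw [mem_supp, hZe]; exact heX.1
        · rw [mem_supp, hZf]; exact hfX.1)
      (fun x hx => by
        have hxa : x ≠ a := by
          rintro rfl
          exact hx.1 hZa
        rcases hZs hx.1 with h1 | h1
        · exact Or.inr ⟨hXA ⟨h1, hx.2⟩, hxa⟩
        · rcases hWsub h1 with rfl | h2
          · exact Or.inl rfl
          · exact Or.inr ⟨h2, hxa⟩) rfl
    exact ⟨Y, hY, hYA, hYD, hYe.trans hZe, hYf.trans hZf⟩

/-- The ratio of the values at `e` and `f` of a vector meeting a cocircuit in `{e, f}` does not
depend on the vector. -/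
lemma mul_eq_mul_of_inter_eq_pair (hC : IsSignature M C) (h : ModularElimination T C)
    (hD : M.IsCocircuit D) {X Y : E → WithZero G} (hX : X ∈ C) (hY : Y ∈ C) {e f : E}
    (hXD : supp X ∩ D = {e, f}) (hYD : supp Y ∩ D = {e, f}) : X e * Y f = Y e * X f := by
  have heX : e ∈ supp X ∩ D := hXD ▸ Set.mem_insert _ _
  have heY : e ∈ supp Y ∩ D := hYD ▸ Set.mem_insert _ _
  obtain ⟨A, hA, hXA⟩ := hC.isBasis_compl hX heX
  obtain ⟨A', hA', hYA⟩ := hC.isBasis_compl hY heY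
  -- After the move, both vectors are supported on `A' ∪ {e, f}`, a base with one extra element,
  -- which contains only one circuit.
  obtain ⟨Z, hZ, hZA, hZD, hZe, hZf⟩ := hC.exists_move h hD hA hA' hX hXD hXA
  have key : ∀ V : E → WithZero G, supp V ∩ D = {e, f} → supp V \ D ⊆ A' →
      supp V ⊆ insert f (insert e A') := fun V hV hVA x hx => by
    by_cases hxD : x ∈ D
    · have : x ∈ ({e, f} : Set E) := hV ▸ ⟨hx, hxD⟩
      rcases this with rfl | rfl <;> simp
    · simp [hVA ⟨hx, hxD⟩]
  obtain ⟨α, rfl⟩ := hC.eq_smul_of_subset_insert hZ hY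
    (isBase_insert_of_isCocircuit hD hA' heX.2).indep (key Z hZD hZA) (key Y hYD hYA)
  rw [← hZe, ← hZf]
  rw [mul_assoc, mul_left_comm]

/-- Every cocircuit supports a vector satisfying the orthogonality relations with the vectors
meeting the cocircuit in two elements. -/
theorem exists_perp (hC : IsSignature M C) (h : ModularElimination T C) (hD : M.IsCocircuit D) :
    ∃ W : E → WithZero G, supp W = D ∧ ∀ X ∈ C, ∀ e f, e ≠ f → supp X ∩ D = {e, f} →
      W e * X e = T.negOne * (W f * X f) := by
  classical
  obtain ⟨o, ho⟩ := hD.nonempty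
  obtain ⟨A₀, hA₀⟩ := M.exists_isBasis (M.E \ D)
  have hV : ∀ f, ∃ V : E → WithZero G, f ∈ D → f ≠ o → V ∈ C ∧ supp V ∩ D = {o, f} := by
    intro f
    by_cases hf : f ∈ D ∧ f ≠ o
    · obtain ⟨V, hV, -, hVD⟩ := hC.exists_inter_eq_pair hD hA₀ hf.2.symm ho hf.1
      exact ⟨V, fun _ _ => ⟨hV, hVD⟩⟩
    · exact ⟨0, fun h1 h2 => absurd ⟨h1, h2⟩ hf⟩
  choose V hV using hV
  -- Normalised at `o`, the value at `f` is dictated by orthogonality to any circuit vector meeting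
  -- `D` in `{o, f}`.
  let W : E → WithZero G := fun f =>
    if f ∈ D then if f = o then 1 else T.negOne * (V f o / V f f) else 0
  have hWo : W o = 1 := by simp [W, ho]
  have hW0 : ∀ f ∈ D, f ≠ o → ∀ X ∈ C, supp X ∩ D = {o, f} →
      W f * X f = T.negOne * X o := by
    intro f hf hfo X hX hXD
    have hVf := hV f hf hfo
    have hne : V f f ≠ 0 := by
      have : f ∈ supp (V f) ∩ D := hVf.2 ▸ Or.inr rfl
      exact this.1
    have hq := hC.mul_eq_mul_of_inter_eq_pair h hD hX hVf.1 hXD hVf.2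
    simp only [W, hf, hfo, if_true, if_false]
    rw [mul_assoc, div_mul_eq_mul_div, ← hq, mul_div_assoc, div_self hne, mul_one]
  refine ⟨W, ?_, ?_⟩
  · ext f
    rw [mem_supp]
    by_cases hf : f ∈ D
    · by_cases hfo : f = o
      · simp [hfo, hWo, ho]
      · have hVf := (hV f hf hfo).2
        have h1 : o ∈ supp (V f) ∩ D := hVf ▸ Set.mem_insert _ _
        have h2 : f ∈ supp (V f) ∩ D := hVf ▸ Or.inr rfl
        simp only [W, hf, hfo, if_true, if_false, iff_true]
        exact mul_ne_zero T.negOne_ne_zero (div_ne_zero h1.1 h2.1)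
    · simp [W, hf]
  · intro X hX e f hef hXD
    have heX : e ∈ supp X ∩ D := hXD ▸ Set.mem_insert _ _
    have hfX : f ∈ supp X ∩ D := hXD ▸ Or.inr rfl
    by_cases heo : e = o
    · subst heo
      rw [hW0 f hfX.2 hef.symm X hX hXD, hWo, one_mul, negOne_mul_cancel_left]
    by_cases hfo : f = o
    · subst hfo
      rw [hW0 e heX.2 hef X hX (by rw [hXD, Set.pair_comm]), hWo, one_mul]
    obtain ⟨A, hA, hXA⟩ := hC.isBasis_compl hX heX
    -- Consistency for a pair avoiding `o`: eliminating `e` between `X` on `{e, f}` and `Y` on `{o,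
    -- e}` yields `Z` on `{o, f}`, and the relations of `Y` and `Z` combine to that of `X`.
    obtain ⟨Y, hY, hYA, hYD⟩ := hC.exists_inter_eq_pair hD hA (Ne.symm heo) ho heX.2
    have heY : e ∈ supp Y ∩ D := hYD ▸ Or.inr rfl
    have hoX : X o = 0 := by
      by_contra h0
      have : o ∈ ({e, f} : Set E) := hXD ▸ ⟨h0, ho⟩
      rcases this with h1 | h1
      · exact heo h1.symm
      · exact hfo h1.symm
    have hfY : Y f = 0 := by
      by_contra h0
      have : f ∈ ({o, e} : Set E) := hYD ▸ ⟨h0, hfX.2⟩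
      rcases this with h1 | h1
      · exact hfo h1
      · exact hef h1.symm
    obtain ⟨c, hc, hce, Z, hZ, hZe, hZs, hZX, hZY⟩ := hC.exists_elimination h hX hY
      (fun hs => by
        have : f ∈ supp Y := hs ▸ hfX.1
        exact this hfY)
      (nullity_le_two (p := e) (q := f) hD hA ho (by
        refine Set.union_subset (fun x hx => ?_) (fun x hx => ?_)
        · by_cases hxD : x ∈ D
          · have : x ∈ ({e, f} : Set E) := hXD ▸ ⟨hx, hxD⟩
            rcases this with rfl | rfl <;> simp
          · simp [hXA ⟨hx, hxD⟩]
        · by_cases hxD : x ∈ D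
          · have : x ∈ ({o, e} : Set E) := hYD ▸ ⟨hx, hxD⟩
            rcases this with rfl | rfl <;> simp
          · simp [hYA ⟨hx, hxD⟩])) heX.1 heY.1
    have hZf : Z f = X f := hZX f hfY
    have hZo : Z o = c * Y o := hZY o hoX
    have hZD : supp Z ∩ D = {o, f} := by
      refine hC.inter_eq_pair hD hZ ⟨by rw [mem_supp, hZf]; exact hfX.1, hfX.2⟩ fun x hx => ?_
      have hxe : x ≠ e := by
        rintro rfl
        exact hx.1 hZe
      rcases hZs hx.1 with h1 | h1
      · have : x ∈ ({e, f} : Set E) := hXD ▸ ⟨h1, hx.2⟩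
        exact Or.inr (this.resolve_left hxe)
      · have : x ∈ ({o, e} : Set E) := hYD ▸ ⟨h1, hx.2⟩
        exact Or.inl (this.resolve_right hxe)
    have h1 := hW0 e heX.2 heo Y hY hYD
    have h2 := hW0 f hfX.2 hfo Z hZ hZD
    rw [hZf, hZo] at h2
    rw [hce, h2, negOne_mul_cancel_left, mul_left_comm, mul_left_comm (W e), h1,
      mul_left_comm c, negOne_mul_cancel_left]

end IsSignature

end Tract

/-! ### Equivalence of elimination and orthogonality -/

namespace Tract

open Matroid

variable {G : Type*} [CommGroup G] {E : Type*} {T : Tract G} {M : Matroid E}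
  {C : Set (E → WithZero G)} {D : Set E} [Fintype E]

namespace IsSignature

/-- Elimination extends the orthogonality relations from intersections with two elements to
all intersections of an allowed size. -/
theorem perp_of_eliminationAt (hC : IsSignature M C) {k : Flavour}
    (helim : ∀ n, k.Allows n → n ≠ 0 → EliminationAt T C n) {W : E → WithZero G}
    (hW : M.IsCocircuit (supp W))
    (hpair : ∀ X ∈ C, ∀ e f, e ≠ f → supp X ∩ supp W = {e, f} →
      W e * X e = T.negOne * (W f * X f)) {X : E → WithZero G} (hX : X ∈ C)
    (hk : k.Allows ((supp W ∩ supp X).ncard - 2)) : Perp T W X := by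
  rw [Set.inter_comm] at hk
  rcases Set.eq_empty_or_nonempty (supp X ∩ supp W) with h0 | hne
  · refine (perp_iff_sum_of_injective (Empty.elim : Empty → E) (fun i => i.elim)
      (by rw [Set.inter_comm, h0]; exact Set.empty_subset _)).2 ?_
    simpa using T.zero_mem
  have htwo : 2 ≤ (supp X ∩ supp W).ncard :=
    Set.one_lt_ncard_iff_nontrivial.2
      ((hC.isCircuit hX).isCocircuit_inter_nontrivial hW hne)
  obtain ⟨n, hn⟩ := Nat.exists_eq_add_of_le' htwo
  rcases Nat.eq_zero_or_pos n with rfl | hnpos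
  · obtain ⟨e, f, hef, hXW⟩ := Set.ncard_eq_two.1 hn
    rw [perp_iff_of_inter_subset_pair hef (by rw [Set.inter_comm, hXW])]
    exact hpair X hX e f hef hXW
  rw [hn, Nat.add_sub_cancel] at hk
  obtain ⟨q⟩ : Nonempty (Fin (n + 2) ≃ (supp X ∩ supp W : Set E)) :=
    ⟨(Finite.equivFinOfCardEq (by rw [Nat.card_coe_set_eq, hn])).symm⟩
  set p : Fin (n + 2) → E := fun i => (q i : E) with hp
  have hpinj : Function.Injective p := Subtype.val_injective.comp q.injective
  have hpmem : ∀ i, p i ∈ supp X ∩ supp W := fun i => (q i).2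
  have hpsurj : ∀ x ∈ supp X ∩ supp W, ∃ i, p i = x := fun x hx =>
    ⟨q.symm ⟨x, hx⟩, by simp [hp]⟩
  -- The intersection has `n + 2` elements: the `n` elements `e i` are eliminated, `g` survives, and
  -- `o` is shared with all auxiliary vectors. This is the source of the `- 2` in the size
  -- condition.
  set o := p 0 with ho
  set g := p (Fin.last (n + 1)) with hg
  set e : Fin n → E := fun i => p i.castSucc.succ with he
  have hinj : Function.Injective e := fun i j hij =>
    Fin.castSucc_injective _ (Fin.succ_injective _ (hpinj hij))
  have hoe : ∀ i, o ≠ e i := fun i h => (Fin.succ_ne_zero _ (hpinj h).symm)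
  have hge : ∀ i, g ≠ e i := fun i h => by
    have := hpinj h
    rw [← Fin.succ_last] at this
    exact (Fin.castSucc_lt_last i).ne (Fin.succ_injective _ this).symm
  have hog : o ≠ g := fun h => by
    have := hpinj h
    rw [← Fin.succ_last] at this
    exact Fin.succ_ne_zero _ this.symm
  have hpcases : ∀ x ∈ supp X ∩ supp W, x = o ∨ x = g ∨ ∃ i, x = e i := fun x hx => by
    obtain ⟨i, rfl⟩ := hpsurj x hx
    induction i using Fin.cases with
    | zero => exact Or.inl rfl
    | succ i =>
      induction i using Fin.lastCases with
      | last => exact Or.inr (Or.inl (by rw [hg, ← Fin.succ_last]))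
      | cast i => exact Or.inr (Or.inr ⟨i, rfl⟩)
  obtain ⟨A, hA, hXA⟩ := hC.isBasis_compl hX (hpmem 0)
  have hB := isBase_insert_of_isCocircuit hW hA (hpmem 0).2
  have hV : ∀ i, ∃ V ∈ C, supp V \ supp W ⊆ A ∧ supp V ∩ supp W = {o, e i} ∧
      X (e i) = T.negOne * V (e i) := by
    intro i
    obtain ⟨V, hV, hVA, hVW⟩ := hC.exists_inter_eq_pair hW hA (hoe i) (hpmem 0).2 (hpmem _).2
    have hVe : V (e i) ≠ 0 := by
      have : e i ∈ supp V ∩ supp W := hVW ▸ Or.inr rfl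
      exact this.1
    have hc : T.negOne * (X (e i) * (V (e i))⁻¹) ≠ 0 :=
      mul_ne_zero T.negOne_ne_zero (mul_ne_zero (hpmem _).1 (inv_ne_zero hVe))
    refine ⟨_, hC.mul_mem hV hc, by rwa [supp_smul hc], by rwa [supp_smul hc], ?_⟩
    rw [mul_assoc, negOne_mul_cancel_left, inv_mul_cancel_right₀ hVe]
  choose V hVC hVA hVW hVX using hV
  have hVe : ∀ i, e i ∈ supp (V i) := fun i => by
    have : e i ∈ supp (V i) ∩ supp W := hVW i ▸ Or.inr rfl
    exact this.1
  have hV0 : ∀ i, ∀ x ∈ supp W, x ≠ o → x ≠ e i → x ∉ supp (V i) := fun i x hx hxo hxe hxV => by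
    have : x ∈ ({o, e i} : Set E) := hVW i ▸ ⟨hxV, hx⟩
    exact this.elim hxo hxe
  let F : Fin (n + 1) → E → WithZero G := Fin.cons X V
  have hFC : ∀ i, F i ∈ C := Fin.cases hX hVC
  have hFc : ∀ i, M.IsCircuit (supp (F i)) := fun i => hC.isCircuit (hFC i)
  have hgV : ∀ i : Fin n, g ∉ supp (F i.succ) := fun i =>
    hV0 i g (hpmem _).2 hog.symm (hge i)
  have heV : ∀ i j : Fin n, j ≠ i → e i ∉ supp (F j.succ) := fun i j hij =>
    hV0 j (e i) (hpmem _).2 (hoe i).symm fun h => hij (hinj h).symm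
  have hFsub : ∀ i, supp (F i) ⊆ insert o A ∪ Set.range (p ∘ Fin.succ) := by
    have hr : ∀ x ∈ supp X ∩ supp W, x ∈ insert o A ∪ Set.range (p ∘ Fin.succ) := fun x hx => by
      obtain ⟨i, rfl⟩ := hpsurj x hx
      induction i using Fin.cases with
      | zero => exact Or.inl (Or.inl rfl)
      | succ i => exact Or.inr ⟨i, rfl⟩
    refine Fin.cases (fun x hx => ?_) (fun i x hx => ?_)
    · by_cases hxW : x ∈ supp W
      · exact hr x ⟨hx, hxW⟩
      · exact Or.inl (Or.inr (hXA ⟨hx, hxW⟩))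
    · by_cases hxW : x ∈ supp W
      · have : x ∈ ({o, e i} : Set E) := hVW i ▸ ⟨hx, hxW⟩
        rcases this with rfl | rfl
        · exact Or.inl (Or.inl rfl)
        · exact hr _ (hpmem _)
      · exact Or.inl (Or.inr (hVA i ⟨hx, hxW⟩))
  -- Above, the union lies in a base plus `n + 1` points; below, `g` and the `e i` form a
  -- transversal.
  have hnull : M.nullity (⋃ i, supp (F i)) = n + 1 := by
    refine le_antisymm ?_ ?_
    · refine (M.nullity_mono (Set.iUnion_subset hFsub)).trans
        ((nullity_le_of_indep_subset hB.indep Set.subset_union_left).trans ?_)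
      rw [Set.union_sdiff_left]
      refine (Set.ncard_le_ncard Set.sdiff_subset (Set.toFinite _)).trans ?_
      rw [← Set.image_univ]
      exact (Set.ncard_image_le Set.finite_univ).trans (by rw [Set.ncard_univ, Nat.card_fin])
    · rw [nullity_iUnion_eq hC.ground_eq hFc (g := g) (hpmem _).1 hgV (e := e) hVe heV]
      exact Nat.le_add_left _ _
  obtain ⟨Z, hZ, hZe, hZf⟩ := helim n hk hnpos.ne' F e hFC
    ((isModularFamily_iff hC.ground_eq hC.isCircuit_iff).2 ⟨hFc, hnull⟩)
    (fun hsub => by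
      obtain ⟨i, hi⟩ := Set.mem_iUnion.1 (hsub (show g ∈ supp (F 0) from (hpmem _).1))
      exact hgV i hi)
    heV (fun i => ⟨hVX i, (hpmem _).1⟩)
  have hZg : Z g = X g := by
    have h1 := hZf g
    rw [Fin.sum_univ_succ, Finset.sum_eq_zero (fun i _ => by
      rw [notMem_supp.1 (hgV i), toSum_zero]), add_zero, T.add_negOne_mem_null_iff] at h1
    exact h1.symm
  have hZW : supp Z ∩ supp W = {o, g} := by
    refine hC.inter_eq_pair hW hZ ⟨by rw [mem_supp, hZg]; exact (hpmem _).1, (hpmem _).2⟩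
      fun x hx => ?_
    have hxe : ∀ i, x ≠ e i := fun i h => hx.1 (h ▸ hZe i)
    by_contra hxn
    rw [Set.mem_insert_iff, Set.mem_singleton_iff, not_or] at hxn
    have h1 : ∀ i, F i x = 0 := by
      refine Fin.cases ?_ fun i => ?_
      · by_contra h0
        rcases hpcases x ⟨h0, hx.2⟩ with h | h | ⟨i, h⟩
        · exact hxn.1 h
        · exact hxn.2 h
        · exact hxe i h
      · exact notMem_supp.1 (hV0 i x hx.2 hxn.1 (hxe i))
    have h2 := hZf x
    rw [Finset.sum_eq_zero (fun i _ => by rw [h1, toSum_zero]), zero_add,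
      T.toSum_mem_null_iff] at h2
    exact hx.1 ((mul_eq_zero.1 h2).resolve_left T.negOne_ne_zero)
  have hWo : W o ≠ 0 := (hpmem 0).2
  -- The elimination relation at `o`, multiplied by `W o`, is the desired sum: the two-element
  -- relations turn `W o * V i o` into `W (e i) * X (e i)` and the term of `Z` into `W g * X g`.
  have hfin := T.null_smul (W o) (hZf o)
  rw [perp_iff_sum_of_injective p hpinj (fun x hx => by
    obtain ⟨i, hi⟩ := hpsurj x ⟨hx.2, hx.1⟩
    exact ⟨i, hi⟩), Fin.sum_univ_succ, Fin.sum_univ_castSucc, ← add_assoc]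
  rw [mul_add, Fin.sum_univ_succ, mul_add, Finset.mul_sum, ← toSum_mul, ← toSum_mul] at hfin
  convert! hfin using 2
  · congr 1
    refine Finset.sum_congr rfl fun i _ => ?_
    rw [← toSum_mul]
    congr 1
    have := hpair _ (hVC i) o (e i) (hoe i) (hVW i)
    change W (e i) * X (e i) = W o * V i o
    rw [this, hVX i, mul_left_comm]
  · congr 1
    have := hpair Z hZ o g hog hZW
    rw [mul_left_comm, this, negOne_mul_cancel_left, hZg, Fin.succ_last]

/-- A family of vectors supported on the cocircuits which is orthogonal to a signature, for
intersections of an allowed size, forces elimination for the signature. -/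
theorem eliminationAt_of_perp (hC : IsSignature M C) {k : Flavour} {K : Set (E → WithZero G)}
    (hK : ∀ D, M.IsCocircuit D → ∃ W ∈ K, supp W = D)
    (hperp : ∀ W ∈ K, ∀ X ∈ C, k.Allows ((supp W ∩ supp X).ncard - 2) → Perp T W X)
    {n : ℕ} (hn : k.Allows n) : EliminationAt T C n := by
  intro X e hX hmod hsub he hXe
  obtain ⟨hXc, hnull⟩ := (isModularFamily_iff hC.ground_eq hC.isCircuit_iff).1 hmod
  obtain ⟨g, hgX, hgX'⟩ := Set.not_subset.1 hsub
  have hg : ∀ i : Fin n, X i.succ g = 0 := fun i => by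
    by_contra h
    exact hgX' (Set.mem_iUnion_of_mem i h)
  have heX : ∀ i, e i ∈ supp (X i.succ) := fun i h => by
    have := (hXe i).1
    rw [h, mul_zero] at this
    exact (hXe i).2 this
  set U := ⋃ i, supp (X i) with hU
  have hXU : ∀ i, supp (X i) ⊆ U := Set.subset_iUnion (fun i => supp (X i))
  set B := U \ insert g (Set.range e) with hB
  have hBind : M.Indep B := by
    have h1 := nullity_iUnion_eq hC.ground_eq hXc hgX (fun i => notMem_supp.2 (hg i)) heX he
    rw [hnull, ← hU, ← hB] at h1
    rw [← nullity_eq_zero_iff]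
    omega
  have hUcl : U ⊆ M.closure B :=
    subset_closure_sdiff_transversal hC.ground_eq hXc hgX (fun i => notMem_supp.2 (hg i)) heX he
  have hgB : g ∉ B := fun h => h.2 (Or.inl rfl)
  have heB : ∀ i, e i ∉ B := fun i h => h.2 (Or.inr ⟨i, rfl⟩)
  have hge : ∀ i, g ≠ e i := fun i h => heX i (h ▸ hg i)
  have hinj : Function.Injective e := fun i j hij => by
    by_contra hne
    exact he i j (Ne.symm hne) (hij ▸ heX j)
  -- Vanishing at all `e i` confines `Z` to `insert g B`, so its support has to be the fundamental
  -- circuit of `g` over the independent set `B`; the value at `g` fixes the scale.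
  obtain ⟨Z₀, hZ₀, hZ₀s⟩ := hC.exists_mem (hBind.fundCircuit_isCircuit (hUcl (hXU 0 hgX)) hgB)
  have hZ₀g : Z₀ g ≠ 0 := by
    have : g ∈ supp Z₀ := hZ₀s ▸ M.mem_fundCircuit g B
    exact this
  have hc : X 0 g * (Z₀ g)⁻¹ ≠ 0 := mul_ne_zero hgX (inv_ne_zero hZ₀g)
  obtain ⟨Z, hZ, hZs, hZg⟩ : ∃ Z ∈ C, supp Z ⊆ insert g B ∧ Z g = X 0 g :=
    ⟨_, hC.mul_mem hZ₀ hc, by rw [supp_smul hc, hZ₀s]; exact M.fundCircuit_subset_insert g B,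
      inv_mul_cancel_right₀ hZ₀g _⟩
  have hZe : ∀ i, Z (e i) = 0 := fun i => by
    by_contra h
    exact (hZs h).elim (fun h => hge i h.symm) (heB i)
  refine ⟨Z, hZ, hZe, fun f => ?_⟩
  by_cases hfU : f ∈ U
  swap
  · have hZf : Z f = 0 := by
      by_contra h
      rcases hZs h with rfl | h
      · exact hfU (hXU 0 hgX)
      · exact hfU h.1
    rw [hZf, mul_zero, toSum_zero, add_zero, Finset.sum_eq_zero]
    · exact T.zero_mem
    · intro i _
      rw [notMem_supp.1 fun h => hfU (hXU i h), toSum_zero]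
  by_cases hfg : f = g
  · subst hfg
    rw [Fin.sum_univ_succ, Finset.sum_eq_zero (fun i _ => by rw [hg, toSum_zero]), add_zero, hZg,
      T.add_negOne_mem_null_iff]
  by_cases hfe : f ∈ Set.range e
  · obtain ⟨i, rfl⟩ := hfe
    rw [Fin.sum_univ_succ, Finset.sum_eq_single i (fun j _ hj => by
      rw [notMem_supp.1 (he i j hj), toSum_zero]) (fun h => absurd (Finset.mem_univ i) h), hZe,
      mul_zero, toSum_zero, add_zero, T.add_mem_null_iff]
    exact (hXe i).1
  have hfB : f ∈ B := ⟨hfU, fun h => h.elim hfg hfe⟩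
  -- A fundamental cocircuit of `f` meets `B` only in `f`. Hence `W` meets `X i.succ` within `{f, e
  -- i}`, `Z` within `{f, g}`, and `X 0` within `f`, `g` and the `e i`, at most `n + 2` elements.
  -- Orthogonality to `X 0` is then `W f` times the elimination relation at `f`.
  obtain ⟨B', hB', hBB'⟩ := hBind.exists_isBase_superset
  obtain ⟨W, hWK, hWs⟩ := hK _ (fundCocircuit_isCocircuit (hBB' hfB) hB')
  have hWB : ∀ x ∈ B, x ∈ supp W → x = f := fun x hx hxW => by
    have h1 : x ∈ M.fundCocircuit f B' ∩ B' := ⟨hWs ▸ hxW, hBB' hx⟩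
    rwa [M.fundCocircuit_inter_eq (hBB' hfB)] at h1
  have hWf : W f ≠ 0 := by
    have : f ∈ supp W := hWs ▸ M.mem_fundCocircuit f B'
    exact this
  have hpair : ∀ Y ∈ C, ∀ x, f ≠ x → supp W ∩ supp Y ⊆ {f, x} →
      W f * Y f = T.negOne * (W x * Y x) := fun Y hY x hfx hsub => by
    refine (perp_iff_of_inter_subset_pair hfx hsub).1 (hperp W hWK Y hY (hn.mono ?_))
    have h1 := Set.ncard_le_ncard hsub (Set.toFinite _)
    have h2 := Set.ncard_insert_le f {x}
    rw [Set.ncard_singleton] at h2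
    omega
  have hX1 : ∀ i : Fin n, W f * X i.succ f = W (e i) * X 0 (e i) := fun i => by
    rw [hpair _ (hX _) (e i) (fun h => hfe ⟨i, h.symm⟩) fun x hx => ?_, (hXe i).1, mul_left_comm]
    by_cases hxB : x ∈ B
    · exact Or.inl (hWB x hxB hx.1)
    by_cases hxe : x = e i
    · exact Or.inr hxe
    refine absurd ⟨hXU _ hx.2, ?_⟩ hxB
    rintro (rfl | ⟨j, rfl⟩)
    · exact hx.2 (hg i)
    · exact he j i (fun h => hxe (by rw [h])) hx.2
  have hZ1 : W f * Z f = T.negOne * (W g * X 0 g) := by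
    rw [hpair Z hZ g hfg fun x hx => ?_, hZg]
    rcases hZs hx.2 with h | h
    · exact Or.inr h
    · exact Or.inl (hWB x h hx.1)
  let p : Fin (n + 2) → E := Fin.cons f (Fin.cons g e)
  have hp : Function.Injective p := by
    rw [Fin.cons_injective_iff, Fin.cons_injective_iff]
    refine ⟨?_, ?_, hinj⟩
    · rw [Fin.range_cons]
      rintro (h | h)
      · exact hfg h
      · exact hfe h
    · rintro ⟨i, h⟩
      exact hge i h.symm
  have hpr : supp W ∩ supp (X 0) ⊆ Set.range p := fun x hx => by
    rw [Fin.range_cons, Fin.range_cons]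
    by_cases hxB : x ∈ B
    · exact Or.inl (hWB x hxB hx.1)
    · right
      by_contra h
      exact hxB ⟨hXU 0 hx.2, h⟩
  have hmain := (perp_iff_sum_of_injective p hp hpr).1 (hperp W hWK (X 0) (hX 0) (hn.mono (by
    have h1 := Set.ncard_le_ncard hpr (Set.toFinite _)
    rw [← Set.image_univ, Set.ncard_image_of_injective _ hp, Set.ncard_univ, Nat.card_fin] at h1
    omega)))
  rw [← T.null_smul_iff hWf, mul_add, Fin.sum_univ_succ, mul_add, Finset.mul_sum, ← toSum_mul,
    ← toSum_mul, mul_left_comm, hZ1, negOne_mul_cancel_left]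
  rw [Fin.sum_univ_succ, Fin.sum_univ_succ, ← add_assoc, add_right_comm] at hmain
  convert! hmain using 3
  refine Finset.sum_congr rfl fun i _ => ?_
  rw [← toSum_mul, hX1]
  rfl

end IsSignature

end Tract

namespace Tract

open Matroid

variable {G : Type*} [CommGroup G] {G' : Type*} [CommGroup G'] {E : Type*} {T : Tract G}
  {T' : Tract G'} {M : Matroid E} {C : Set (E → WithZero G)} {k : Flavour}

/-! ### Duality -/

/-- A signature satisfying elimination for families of every allowed size is the set of circuits
of a matroid over the tract. -/
def IsSignature.toFMatroid (hC : IsSignature M C)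
    (helim : ∀ n, k.Allows n → EliminationAt T C n) : FMatroid k T E where
  circuits := C
  zero_notMem := hC.zero_notMem
  smul_mem := hC.smul_mem
  incomparable := hC.incomparable
  elimination := match k with
    | .weak => modularElimination_of_eliminationAt_one hC.zero_notMem hC.incomparable
        (helim 1 le_rfl)
    | .strong => fun n => helim n trivial

section Fintype

variable [Fintype E]

/-- An intersection of size at most three is one whose size minus two is at most one, so the two
definitions take a common form. -/
lemma mem_orthComplement {τ : Involution T} {Y : E → WithZero G} :
    Y ∈ orthComplement k τ C ↔
      ∀ X ∈ C, k.Allows ((supp Y ∩ supp X).ncard - 2) → Orthogonal τ Y X := by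
  cases k with
  | weak =>
    simp only [orthComplement, Flavour.Allows, Set.mem_ofPred_eq, Nat.sub_le_iff_le_add]
  | strong => simp [orthComplement, Flavour.Allows]

lemma smul_mem_orthComplement {τ : Involution T} {Y : E → WithZero G}
    (hY : Y ∈ orthComplement k τ C) {c : WithZero G} (hc : c ≠ 0) :
    (fun e => c * Y e) ∈ orthComplement k τ C := by
  rw [mem_orthComplement] at hY ⊢
  intro X hX hk
  rw [supp_smul hc] at hk
  simpa using (orthogonal_smul hc one_ne_zero).2 (hY X hX hk)

namespace FMatroid

variable {N : FMatroid k T E}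

/-- Every cocircuit supports a vector of the orthogonal complement. -/
lemma exists_mem_orthComplement (τ : Involution T) (hM : IsSignature M N.circuits) {D : Set E}
    (hD : M.IsCocircuit D) : ∃ Y ∈ orthComplement k τ N.circuits, supp Y = D := by
  obtain ⟨W, rfl, hW⟩ := hM.exists_perp N.modularElimination hD
  refine ⟨fun e => τ.map (W e), mem_orthComplement.2 fun X hX hk => ?_, supp_map _ W⟩
  rw [supp_map] at hk
  rw [orthogonal_iff_perp_left]
  simp only [Involution.map_map]
  exact hM.perp_of_eliminationAt (fun n hn hn' => N.eliminationAt hM hn hn') hD hW hX hk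

/-- If the support were independent in `M✶`, some circuit of `M` would meet it in exactly one
element, and orthogonality would make a single nonzero term null. -/
lemma exists_isCocircuit_subset (τ : Involution T) (hM : IsSignature M N.circuits)
    {Y : E → WithZero G} (hY : Y ∈ orthComplement k τ N.circuits) (h0 : Y ≠ 0) :
    ∃ D ⊆ supp Y, M.IsCocircuit D := by
  suffices M✶.Dep (supp Y) from this.exists_isCircuit_subset
  rw [← not_indep_iff (show supp Y ⊆ M✶.E from hM.subset_ground _)]
  intro hind
  obtain ⟨e, he⟩ : (supp Y).Nonempty := by
    rwa [Set.nonempty_iff_ne_empty, Ne, supp_eq_empty]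
  obtain ⟨K, hK, hKY⟩ := hind.exists_isCocircuit_inter_eq_mem he
  rw [dual_isCocircuit_iff] at hK
  obtain ⟨X, hX, rfl⟩ := hM.exists_mem hK
  have hp := mem_orthComplement.1 hY X hX (k.allows_one.mono (by
    rw [Set.inter_comm, hKY, Set.ncard_singleton]; exact Nat.zero_le _))
  rw [orthogonal_iff_perp_right, perp_iff_sum_of_injective (fun _ : Unit => e)
    (Function.injective_of_subsingleton _)
    (by rw [supp_map, Set.inter_comm, hKY]; rintro x rfl; exact ⟨(), rfl⟩)] at hp
  have hmem : e ∈ supp X ∩ supp Y := hKY ▸ Set.mem_singleton e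
  rw [Finset.univ_unique, Finset.sum_singleton, T.toSum_mem_null_iff, mul_eq_zero,
    Hom.map_eq_zero_iff] at hp
  exact hp.elim hmem.2 hmem.1

/-- The cocircuits are the vectors of the orthogonal complement supported on a cocircuit of the
underlying matroid. -/
lemma mem_cocircuits_iff (τ : Involution T) (hM : IsSignature M N.circuits)
    {Y : E → WithZero G} :
    Y ∈ N.cocircuits τ ↔ M.IsCocircuit (supp Y) ∧ Y ∈ orthComplement k τ N.circuits := by
  constructor
  · rintro ⟨⟨hY, hY0⟩, hmin⟩
    obtain ⟨D, hDY, hD⟩ := exists_isCocircuit_subset τ hM hY hY0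
    obtain ⟨Y', hY', rfl⟩ := exists_mem_orthComplement τ hM hD
    refine ⟨?_, hY⟩
    rwa [← hmin Y' ⟨hY', fun h => hD.nonempty.ne_empty (supp_eq_empty.2 h)⟩ hDY]
  · rintro ⟨hD, hY⟩
    refine ⟨⟨hY, fun h => hD.nonempty.ne_empty (supp_eq_empty.2 h)⟩, fun Y' hY' hsub => ?_⟩
    obtain ⟨D, hDY, hD'⟩ := exists_isCocircuit_subset τ hM hY'.1 hY'.2
    refine hsub.antisymm ?_
    rw [← hD'.isCircuit.eq_of_subset_isCircuit hD.isCircuit (hDY.trans hsub)]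
    exact hDY

/-- The cocircuits form a signature of the dual matroid. -/
lemma isSignature_cocircuits (τ : Involution T) (hM : IsSignature M N.circuits) :
    IsSignature M✶ (N.cocircuits τ) where
  ground_eq := hM.ground_eq
  isCircuit_iff A := by
    constructor
    · intro hA
      obtain ⟨Y, hY, rfl⟩ := exists_mem_orthComplement τ hM hA
      exact ⟨Y, (mem_cocircuits_iff τ hM).2 ⟨hA, hY⟩, rfl⟩
    · rintro ⟨Y, hY, rfl⟩
      exact ((mem_cocircuits_iff τ hM).1 hY).1
  smul_mem Y hY α := by
    rw [mem_cocircuits_iff τ hM] at hY ⊢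
    rw [supp_smul WithZero.coe_ne_zero]
    exact ⟨hY.1, smul_mem_orthComplement hY.2 WithZero.coe_ne_zero⟩
  incomparable Y hY Y' hY' hsub := by
    rw [mem_cocircuits_iff τ hM] at hY hY'
    have hs : supp Y = supp Y' := hY.1.isCircuit.eq_of_subset_isCircuit hY'.1.isCircuit hsub
    obtain ⟨o, ho⟩ := hY.1.nonempty
    have ho' : o ∈ supp Y' := hs ▸ ho
    rw [mem_supp] at ho ho'
    obtain ⟨α, hα⟩ := WithZero.ne_zero_iff_exists.1 (mul_ne_zero ho (inv_ne_zero ho'))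
    refine ⟨α, funext fun f => ?_⟩
    rw [hα]
    by_cases hfo : f = o
    · rw [hfo, inv_mul_cancel_right₀ ho']
    by_cases hf : f ∈ supp Y
    swap
    · have hf' : f ∉ supp Y' := hs ▸ hf
      rw [notMem_supp.1 hf, notMem_supp.1 hf', mul_zero]
    -- A circuit meeting the support in `{f, o}` fixes the ratio of values at `f` and `o`, for both
    -- vectors alike.
    obtain ⟨A, hA⟩ := M.exists_isBasis (M.E \ supp Y)
    obtain ⟨X, hX, -, hXY⟩ := hM.exists_inter_eq_pair hY.1 hA hfo hf ho
    have hfX : f ∈ supp X ∩ supp Y := hXY ▸ Set.mem_insert _ _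
    have key : ∀ V, supp V = supp Y → V ∈ orthComplement k τ N.circuits →
        V f * τ.map (X f) = T.negOne * (V o * τ.map (X o)) := fun V hV hVo => by
      have hsub : supp V ∩ supp X = {f, o} := by rw [hV, Set.inter_comm, hXY]
      refine (perp_iff_of_inter_subset_pair hfo (by rw [supp_map, hsub])).1
        (mem_orthComplement.1 hVo X hX (k.allows_one.mono ?_))
      rw [hsub, Set.ncard_pair hfo]
      exact Nat.zero_le _
    have hτX : τ.map (X f) ≠ 0 := fun h => hfX.1 (τ.toHom.map_eq_zero_iff.1 h)
    apply mul_right_cancel₀ hτX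
    rw [key Y rfl hY.2, mul_assoc, key Y' hs.symm hY'.2, mul_left_comm _ T.negOne,
      ← mul_assoc _ (Y' o), inv_mul_cancel_right₀ ho']

/-- The cocircuits of `M✶` are the circuits of `M`, so the conjugated circuit vectors are the
orthogonal family from which elimination follows. -/
lemma eliminationAt_cocircuits (τ : Involution T) (hM : IsSignature M N.circuits) {n : ℕ}
    (hn : k.Allows n) : EliminationAt T (N.cocircuits τ) n := by
  refine (isSignature_cocircuits τ hM).eliminationAt_of_perp (k := k)
    (K := (fun X e => τ.map (X e)) '' N.circuits) (fun D hD => ?_) ?_ hn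
  · rw [dual_isCocircuit_iff] at hD
    obtain ⟨X, hX, rfl⟩ := hM.exists_mem hD
    exact ⟨_, ⟨X, hX, rfl⟩, supp_map _ X⟩
  · rintro _ ⟨X, hX, rfl⟩ Y hY hk
    rw [supp_map, Set.inter_comm] at hk
    exact (orthogonal_iff_perp_left τ).1
      (mem_orthComplement.1 ((mem_cocircuits_iff τ hM).1 hY).2 X hX hk).symm

/-- Every matroid over a tract has a dual. -/
theorem exists_isDual (N : FMatroid k T E) (τ : Involution T) :
    ∃ N' : FMatroid k T E, N.IsDual τ N' := by
  obtain ⟨M, hM⟩ := N.exists_isSignature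
  exact ⟨(isSignature_cocircuits τ hM).toFMatroid fun n hn => eliminationAt_cocircuits τ hM hn, rfl⟩

/-- Duality is an involution. -/
theorem IsDual.symm {N N' : FMatroid k T E} {τ : Involution T} (h : N.IsDual τ N') :
    N'.IsDual τ N := by
  obtain ⟨M, hM⟩ := N.exists_isSignature
  have hM' : IsSignature M✶ N'.circuits := h ▸ isSignature_cocircuits τ hM
  have hsub : N.circuits ⊆ N'.cocircuits τ := fun X hX => by
    rw [mem_cocircuits_iff τ hM', dual_isCocircuit_iff, mem_orthComplement]
    refine ⟨hM.isCircuit hX, fun Y hY hk => ?_⟩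
    rw [h] at hY
    rw [Set.inter_comm] at hk
    exact (mem_orthComplement.1 ((mem_cocircuits_iff τ hM).1 hY).2 X hX hk).symm
  -- Both sides are signatures of the same matroid, so one inclusion suffices.
  refine hsub.antisymm fun Y hY => ?_
  have hYs := ((mem_cocircuits_iff τ hM').1 hY).1
  rw [dual_isCocircuit_iff] at hYs
  obtain ⟨X, hX, hXY⟩ := hM.exists_mem hYs
  obtain ⟨α, rfl⟩ := (isSignature_cocircuits τ hM').incomparable Y hY X (hsub hX) hXY.symm.subset
  exact hM.smul_mem X hX α

end FMatroid

end Fintype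

/-! ### Push-forward -/

lemma IsSignature.pushSet (hC : IsSignature M C) (f : Hom T T') :
    IsSignature M (f.pushSet C) where
  ground_eq := hC.ground_eq
  isCircuit_iff A := by
    rw [hC.isCircuit_iff]
    constructor
    · rintro ⟨X, hX, rfl⟩
      exact ⟨_, ⟨1, X, hX, rfl⟩, by rw [supp_smul WithZero.coe_ne_zero, supp_map]⟩
    · rintro ⟨_, ⟨c, X, hX, rfl⟩, rfl⟩
      exact ⟨X, hX, by rw [supp_smul WithZero.coe_ne_zero, supp_map]⟩
  smul_mem := by
    rintro _ ⟨c, X, hX, rfl⟩ α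
    exact ⟨α * c, X, hX, by simp [mul_assoc]⟩
  incomparable := by
    rintro _ ⟨c, X, hX, rfl⟩ _ ⟨d, Y, hY, rfl⟩ hsub
    simp only [supp_smul WithZero.coe_ne_zero, supp_map] at hsub
    obtain ⟨α, rfl⟩ := hC.incomparable X hX Y hY hsub
    refine ⟨c * f.toMonoidHom α * d⁻¹, funext fun e => ?_⟩
    simp only [Hom.map_mul, Hom.map_coe, WithZero.coe_mul, WithZero.coe_inv]
    rw [← mul_assoc _ (d : WithZero G'), inv_mul_cancel_right₀ WithZero.coe_ne_zero, mul_assoc]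

/-- Elimination is preserved by push-forward: after rescaling, the vectors to be eliminated are
the images of vectors that match in the source. -/
lemma EliminationAt.pushSet [Finite E] (hC : IsSignature M C) (f : Hom T T') {n : ℕ}
    (h : EliminationAt T C n) : EliminationAt T' (f.pushSet C) n := by
  intro X' e hX' hmod hsub he hXe
  rw [isModularFamily_iff hC.ground_eq (hC.pushSet f).isCircuit_iff] at hmod
  obtain ⟨c, X, hX, hcX⟩ := hX' 0
  have hY : ∀ i : Fin n, ∃ Y ∈ C, X (e i) = T.negOne * Y (e i) ∧
      X' i.succ = fun x => (c : WithZero G') * f.map (Y x) := by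
    intro i
    obtain ⟨d, Y, hY, hdY⟩ := hX' i.succ
    obtain ⟨h1, h2⟩ := hXe i
    have hXi : X (e i) ≠ 0 := fun h0 => h2 (by simp [hcX, h0])
    have hYi : Y (e i) ≠ 0 := fun h0 => h2 (by simp [h1, hdY, h0])
    have hs : T.negOne * (X (e i) * (Y (e i))⁻¹) ≠ 0 :=
      mul_ne_zero T.negOne_ne_zero (mul_ne_zero hXi (inv_ne_zero hYi))
    refine ⟨_, hC.mul_mem hY hs, ?_, funext fun x => ?_⟩
    · rw [mul_assoc, negOne_mul_cancel_left, inv_mul_cancel_right₀ hYi]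
    -- The matching condition at `e i` forces `d / c` into the image of `f`; one constant `c`
    -- therefore serves the whole family.
    · have hd : (d : WithZero G') = c * f.map (T.negOne * (X (e i) * (Y (e i))⁻¹)) := by
        have hfY : f.map (Y (e i)) ≠ 0 := by rwa [Ne, Hom.map_eq_zero_iff]
        simp only [hcX, hdY] at h1
        apply mul_right_cancel₀ hfY
        rw [mul_assoc, ← f.map_mul, mul_assoc, inv_mul_cancel_right₀ hYi, f.map_mul, f.map_negOne,
          mul_left_comm, h1, negOne_mul_cancel_left]
      rw [hdY, f.map_mul, ← mul_assoc, ← hd]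
  choose Y hYC hXY hX'Y using hY
  have hF : ∀ i, (Fin.cons X Y : Fin (n + 1) → E → WithZero G) i ∈ C := Fin.cases hX hYC
  have hX'F : ∀ i, X' i = fun x =>
      (c : WithZero G') * f.map ((Fin.cons X Y : Fin (n + 1) → E → WithZero G) i x) :=
    Fin.cases hcX hX'Y
  have hsupp : ∀ i, supp (X' i) = supp ((Fin.cons X Y : Fin (n + 1) → E → WithZero G) i) :=
    fun i => by rw [hX'F i, supp_smul WithZero.coe_ne_zero, supp_map]
  simp only [hsupp] at hmod hsub he
  obtain ⟨Z, hZ, hZe, hZf⟩ := h _ e hF ((isModularFamily_iff hC.ground_eq hC.isCircuit_iff).2 hmod)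
    hsub he (fun i => ⟨hXY i, fun h0 => (hXe i).2 (by
      rw [hcX]; exact (by simpa using h0 : (c : WithZero G') * f.map (X (e i)) = 0))⟩)
  refine ⟨_, ⟨c, Z, hZ, rfl⟩, fun i => by simp [hZe], fun x => ?_⟩
  have h1 := T'.null_smul c (f.sum_add_mem_null _ (hZf x))
  rw [mul_add, Finset.mul_sum, f.map_mul, f.map_negOne, ← toSum_mul, mul_left_comm] at h1
  simpa only [hX'F, toSum_mul] using h1

namespace FMatroid

/-- The push-forward of a matroid along a homomorphism of tracts. -/
theorem exists_push [Finite E] (N : FMatroid k T E) (f : Hom T T') :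
    ∃ N' : FMatroid k T' E, N'.circuits = f.pushSet N.circuits := by
  obtain ⟨M, hM⟩ := N.exists_isSignature
  refine ⟨(hM.pushSet f).toFMatroid fun n hn => ?_, rfl⟩
  rcases Nat.eq_zero_or_pos n with rfl | hn0
  · intro X e hX _ _ _ _
    exact ⟨X 0, hX 0, fun i => i.elim0, fun x => by simp [T'.add_negOne_mem_null_iff]⟩
  · exact (N.eliminationAt hM hn hn0.ne').pushSet hM f

/-- Cocircuits of the push-forward are push-forwards of cocircuits. -/
theorem cocircuits_push [Fintype E] {τ : Involution T} {τ' : Involution T'} {f : Hom T T'}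
    (hf : ∀ x : WithZero G, f.map (τ.map x) = τ'.map (f.map x)) {N : FMatroid k T E}
    {N' : FMatroid k T' E} (h : N'.circuits = f.pushSet N.circuits) :
    N'.cocircuits τ' = f.pushSet (N.cocircuits τ) := by
  obtain ⟨M, hM⟩ := N.exists_isSignature
  have hM' : IsSignature M N'.circuits := h ▸ hM.pushSet f
  have hsub : f.pushSet (N.cocircuits τ) ⊆ N'.cocircuits τ' := by
    rintro _ ⟨c, Y, hY, rfl⟩
    rw [mem_cocircuits_iff τ hM] at hY
    refine (isSignature_cocircuits τ' hM').smul_mem _ ?_ c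
    rw [mem_cocircuits_iff τ' hM', supp_map, mem_orthComplement, h]
    refine ⟨hY.1, ?_⟩
    rintro _ ⟨d, X, hX, rfl⟩ hk
    rw [supp_map, supp_smul WithZero.coe_ne_zero, supp_map] at hk
    simpa using (orthogonal_smul (c := 1) one_ne_zero WithZero.coe_ne_zero).2
      ((mem_orthComplement.1 hY.2 X hX hk).map (τ' := τ') f hf)
  -- Each cocircuit of `M` already supports a pushed vector, to which `Y` must be proportional.
  refine Set.Subset.antisymm (fun Y hY => ?_) hsub
  have hYs := ((mem_cocircuits_iff τ' hM').1 hY).1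
  obtain ⟨Y₀, hY₀, hs⟩ := (isSignature_cocircuits τ hM).exists_mem hYs
  have hY₀' : (fun e => ((1 : G') : WithZero G') * f.map (Y₀ e)) ∈ f.pushSet (N.cocircuits τ) :=
    ⟨1, Y₀, hY₀, rfl⟩
  obtain ⟨α, hα⟩ := (isSignature_cocircuits τ' hM').incomparable Y hY _ (hsub hY₀')
    (by rw [supp_smul WithZero.coe_ne_zero, supp_map, hs])
  exact ⟨α, Y₀, hY₀, by simpa using hα⟩

end FMatroid

end Tract

namespace Tract

open Matroid

variable {G : Type*} [CommGroup G] {G' : Type*} [CommGroup G'] {E : Type*} {T : Tract G}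
  {T' : Tract G'} {M : Matroid E} {k : Flavour} {r : ℕ} {φ : (Fin r → E) → WithZero G}

/-! ### Alternating functions -/

lemma negOne_pow_congr (T : Tract G) {m n : ℕ} (h : (-1 : ℤˣ) ^ m = (-1) ^ n) :
    T.negOne ^ m = T.negOne ^ n := by
  have key : ∀ m : ℕ, T.negOne ^ m = if (-1 : ℤˣ) ^ m = 1 then 1 else T.negOne := by
    intro m
    rcases Nat.even_or_odd m with hm | hm
    · obtain ⟨a, rfl⟩ := hm
      rw [Even.neg_one_pow ⟨a, rfl⟩, if_pos rfl, pow_add, ← mul_pow, negOne_mul_negOne, one_pow]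
    · obtain ⟨a, rfl⟩ := hm
      rw [Odd.neg_one_pow ⟨a, rfl⟩, if_neg (by decide), pow_succ, pow_mul, sq,
        negOne_mul_negOne, one_pow, one_mul]
  rw [key, key, h]

namespace IsGPFunction

lemma injective (h : IsGPFunction k T φ) {x : Fin r → E} (hx : φ x ≠ 0) :
    Function.Injective x := fun i j hij => by
  by_contra hne
  exact hx (h.map_eq_zero x i j hne hij)

lemma apply_comp_perm (h : IsGPFunction k T φ) (σ : Equiv.Perm (Fin r)) :
    ∃ m : ℕ, Equiv.Perm.sign σ = (-1) ^ m ∧ ∀ x, φ (x ∘ σ) = T.negOne ^ m * φ x := by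
  induction σ using Equiv.Perm.swap_induction_on with
  | one => exact ⟨0, by simp, fun x => by simp⟩
  | swap_mul σ i j hij ih =>
    obtain ⟨m, hm, hσ⟩ := ih
    refine ⟨m + 1, by rw [map_mul, Equiv.Perm.sign_swap hij, hm, pow_succ'], fun x => ?_⟩
    have : x ∘ (Equiv.swap i j * σ : Equiv.Perm (Fin r)) = (x ∘ Equiv.swap i j) ∘ σ := rfl
    rw [this, hσ, h.map_swap x i j hij, pow_succ, mul_assoc]

/-- Omitting entry `j + 1` leaves `x 0` in front, and a cycle of sign `(-1)^j` carries it to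
position `j`. This absorbs the signs of the circuit formula, so that `BasisRelation` has a single
sign. -/
lemma apply_comp_succAbove (h : IsGPFunction k T φ) (x : Fin (r + 1) → E) (j : Fin r) :
    φ (x ∘ j.succ.succAbove) =
      T.negOne ^ (j : ℕ) * φ (Function.update (x ∘ Fin.succ) j (x 0)) := by
  obtain ⟨m, hm, hσ⟩ := h.apply_comp_perm j.cycleRange
  rw [Fin.sign_cycleRange] at hm
  have hx : Function.update (x ∘ Fin.succ) j (x 0) = (x ∘ j.succ.succAbove) ∘ j.cycleRange := by
    funext i
    rw [Function.comp_apply, Function.comp_apply, Fin.succAbove_cycleRange]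
    by_cases hij : i = j
    · subst hij
      simp
    · rw [Function.update_of_ne hij, Equiv.swap_apply_of_ne_of_ne (Fin.succ_ne_zero i)
        (fun h => hij (Fin.succ_injective _ h))]
      rfl
  rw [hx, hσ, T.negOne_pow_congr hm, ← mul_assoc, ← mul_pow, negOne_mul_negOne, one_pow, one_mul]

/-- Tuples with the same range are permutations of each other when one is injective. -/
lemma exists_perm {x y : Fin r → E} (hx : Function.Injective x)
    (hxy : Set.range y = Set.range x) : ∃ σ : Equiv.Perm (Fin r), y = x ∘ σ := by
  have hs : ∀ i, ∃ j, x j = y i := fun i => by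
    have : y i ∈ Set.range x := hxy ▸ ⟨i, rfl⟩
    exact this
  choose s hs using hs
  have hsurj : Function.Surjective s := fun j => by
    have : x j ∈ Set.range y := hxy ▸ ⟨j, rfl⟩
    obtain ⟨i, hi⟩ := this
    exact ⟨i, hx ((hs i).trans hi)⟩
  exact ⟨Equiv.ofBijective s (Finite.surjective_iff_bijective.1 hsurj), funext fun i => (hs i).symm⟩

lemma ne_zero_of_isBase (h : IsGPFunction k T φ) (hM : IsUnderlyingMatroid φ M) {x : Fin r → E}
    (hx : M.IsBase (Set.range x)) : φ x ≠ 0 := by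
  obtain ⟨y, hy, hy0⟩ := (hM.2 _).1 hx
  obtain ⟨σ, rfl⟩ := exists_perm (h.injective hy0) hy.symm
  obtain ⟨m, -, hσ⟩ := h.apply_comp_perm σ
  rw [hσ]
  exact mul_ne_zero (pow_ne_zero _ T.negOne_ne_zero) hy0

end IsGPFunction

lemma IsUnderlyingMatroid.isBase {G₀ : Type*} {φ : (Fin r → E) → WithZero G₀}
    (hM : IsUnderlyingMatroid φ M) {x : Fin r → E} (hx : φ x ≠ 0) :
    M.IsBase (Set.range x) := (hM.2 _).2 ⟨x, rfl, hx⟩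

/-! ### Three-term Grassmann-Plücker relations -/

lemma IsGPFunction.gpSum_mem_null {s : ℕ} {φ : (Fin (s + 1) → E) → WithZero G}
    (h : IsGPFunction k T φ) {x : Fin (s + 2) → E} {y : Fin s → E} (hx : Function.Injective x)
    (hy : Function.Injective y) (hxy : (Set.range x \ Set.range y).ncard = 3) :
    gpSum T φ x y ∈ T.null := by
  cases k with
  | weak => exact h.relations.2 x y hx hy hxy
  | strong => exact h.relations x y hx hy

lemma IsGPFunction.cons_swap {t : ℕ} {φ : (Fin (t + 2) → E) → WithZero G}
    (h : IsGPFunction k T φ) (p q : E) (β : Fin t → E) :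
    φ (Fin.cons p (Fin.cons q β)) = T.negOne * φ (Fin.cons q (Fin.cons p β)) := by
  rw [← h.map_swap _ 0 1 (by simp)]
  congr 1
  funext i
  refine Fin.cases ?_ (fun i => Fin.cases ?_ (fun i => ?_) i) i
  · simp
  · simp
  · have h1 : i.succ.succ ≠ (1 : Fin (t + 2)) :=
      fun h => Fin.succ_ne_zero i (Fin.succ_injective _ h)
    rw [Function.comp_apply, Equiv.swap_apply_of_ne_of_ne (Fin.succ_ne_zero _) h1]
    rfl

/-- Take the relation for `(d, f, c, β)` and `(e, β)`. Entries of `β` contribute zero by repetition,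
the term of `f` contains `φ(f, e, β) = 0`, and two terms remain. -/
lemma IsGPFunction.mul_eq_mul_cons {t : ℕ} {φ : (Fin (t + 2) → E) → WithZero G}
    (h : IsGPFunction k T φ) {f c e d : E} {β : Fin t → E}
    (hb : Function.Injective (Fin.cons f (Fin.cons c β) : Fin (t + 2) → E))
    (he : e ∉ Set.range (Fin.cons f (Fin.cons c β) : Fin (t + 2) → E))
    (hd : d ∉ Set.range (Fin.cons f (Fin.cons c β) : Fin (t + 2) → E)) (hed : e ≠ d)
    (h0 : φ (Fin.cons f (Fin.cons e β)) = 0) :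
    φ (Fin.cons f (Fin.cons c β)) * φ (Fin.cons e (Fin.cons d β)) =
      φ (Fin.cons f (Fin.cons d β)) * φ (Fin.cons e (Fin.cons c β)) := by
  have hβ := (Fin.cons_injective_iff.1 (Fin.cons_injective_iff.1 hb).2)
  have hf := (Fin.cons_injective_iff.1 hb).1
  rw [Fin.range_cons, Fin.range_cons] at he hd
  rw [Fin.range_cons] at hf
  simp only [Set.mem_insert_iff, not_or] at he hd hf
  have hx : Function.Injective (Fin.cons d (Fin.cons f (Fin.cons c β)) : Fin (t + 3) → E) := by
    rw [Fin.cons_injective_iff]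
    refine ⟨?_, hb⟩
    rw [Fin.range_cons, Fin.range_cons]
    simpa using hd
  have hy : Function.Injective (Fin.cons e β : Fin (t + 1) → E) :=
    Fin.cons_injective_iff.2 ⟨he.2.2, hβ.2⟩
  have hrel := h.gpSum_mem_null hx hy (by
    have : Set.range (Fin.cons d (Fin.cons f (Fin.cons c β)) : Fin (t + 3) → E) \
        Set.range (Fin.cons e β : Fin (t + 1) → E) = {d, f, c} := by
      ext z
      simp only [Fin.range_cons, Set.mem_sdiff, Set.mem_insert_iff, Set.mem_singleton_iff, not_or]
      constructor
      · tauto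
      · rintro (rfl | rfl | rfl)
        · exact ⟨Or.inl rfl, Ne.symm hed, hd.2.2⟩
        · exact ⟨Or.inr (Or.inl rfl), Ne.symm he.1, hf.2⟩
        · exact ⟨Or.inr (Or.inr (Or.inl rfl)), Ne.symm he.2.1, hβ.1⟩
    rw [this, Set.ncard_eq_three]
    exact ⟨d, f, c, hd.1, hd.2.1, hf.1, rfl⟩)
  have hx0 : (Fin.cons d (Fin.cons f (Fin.cons c β)) : Fin (t + 3) → E) ∘ Fin.succAbove 0 =
      Fin.cons f (Fin.cons c β) := by
    funext i; simp
  have hx2 : (Fin.cons d (Fin.cons f (Fin.cons c β)) : Fin (t + 3) → E) ∘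
      Fin.succAbove (Fin.succ (Fin.succ 0)) = Fin.cons d (Fin.cons f β) := by
    funext i
    refine Fin.cases ?_ (fun i => Fin.cases ?_ (fun i => ?_) i) i
    · rw [Function.comp_apply, Fin.succ_succAbove_zero]
      rfl
    · rw [Function.comp_apply, Fin.succ_succAbove_succ]
      simp
    · rw [Function.comp_apply, Fin.succ_succAbove_succ, Fin.succ_succAbove_succ]
      simp
  rw [gpSum, Fin.sum_univ_succ, Fin.sum_univ_succ, Fin.sum_univ_succ,
    Finset.sum_eq_zero (fun i _ => ?_), add_zero, hx0, hx2] at hrel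
  · simp only [Fin.cons_zero, Fin.cons_succ, h0, mul_zero, toSum_zero, zero_add,
      Fin.val_zero, Fin.val_succ, T.add_mem_null_iff] at hrel
    rw [h.cons_swap d f, h.cons_swap c e, h.cons_swap d e] at hrel
    have h3 : T.negOne ^ (1 + 1 + 1) = T.negOne := by
      rw [show 1 + 1 + 1 = 2 + 1 from rfl, pow_succ, sq, negOne_mul_negOne, one_mul]
    rw [h3, pow_one] at hrel
    simp only [mul_left_comm _ T.negOne, mul_assoc, negOne_mul_cancel_left] at hrel
    exact hrel
  · have : φ (Fin.cons ((Fin.cons d (Fin.cons f (Fin.cons c β)) : Fin (t + 3) → E)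
        i.succ.succ.succ) (Fin.cons e β)) = 0 :=
      h.map_eq_zero _ 0 i.succ.succ (Fin.succ_ne_zero _).symm (by simp)
    rw [this, mul_zero, mul_zero, toSum_zero]

/-- A three-term relation with one vanishing term, at arbitrary positions of a basis. -/
lemma IsGPFunction.mul_eq_mul_update (h : IsGPFunction k T φ) {b : Fin r → E} (hb : φ b ≠ 0)
    {i j : Fin r} (hij : i ≠ j) {e d : E} (he : e ∉ Set.range b) (hd : d ∉ Set.range b)
    (hed : e ≠ d) (h0 : φ (Function.update b j e) = 0) :
    φ b * φ (Function.update (Function.update b i e) j d) =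
      φ (Function.update b j d) * φ (Function.update b i e) := by
  obtain ⟨t, rfl⟩ : ∃ t, r = t + 2 := by
    have h1 := i.isLt
    have h2 := j.isLt
    have h3 : (i : ℕ) ≠ j := fun h => hij (Fin.ext h)
    exact ⟨r - 2, by omega⟩
  -- Positions `i` and `j` are permuted to the front; the sign enters twice on each side and
  -- cancels.
  obtain ⟨σ, hσ0, hσ1⟩ : ∃ σ : Equiv.Perm (Fin (t + 2)), σ 0 = i ∧ σ 1 = j := by
    refine ⟨Equiv.swap 0 i * Equiv.swap 1 (Equiv.swap 0 i j), ?_, ?_⟩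
    · have hne : (0 : Fin (t + 2)) ≠ Equiv.swap 0 i j := fun h => by
        have := congrArg (Equiv.swap 0 i) h
        rw [Equiv.swap_apply_left, Equiv.swap_apply_self] at this
        exact hij this
      rw [Equiv.Perm.mul_apply, Equiv.swap_apply_of_ne_of_ne (a := 1) (x := 0) (by simp) hne,
        Equiv.swap_apply_left]
    · rw [Equiv.Perm.mul_apply, Equiv.swap_apply_left, Equiv.swap_apply_self]
  obtain ⟨m, -, hm⟩ := h.apply_comp_perm σ
  have hc : T.negOne ^ m ≠ 0 := pow_ne_zero _ T.negOne_ne_zero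
  set β : Fin t → E := fun n => b (σ n.succ.succ) with hβ
  have hcons : ∀ x : Fin (t + 2) → E, (∀ n, n ≠ i → n ≠ j → x n = b n) →
      x ∘ σ = Fin.cons (x i) (Fin.cons (x j) β) := by
    intro x hx
    funext n
    refine Fin.cases ?_ (fun n => Fin.cases ?_ (fun n => ?_) n) n
    · simp [hσ0]
    · simp [← hσ1]
    · rw [Function.comp_apply, hx]
      · rfl
      · rw [← hσ0]
        exact fun h => Fin.succ_ne_zero _ (σ.injective h)
      · rw [← hσ1]
        exact fun h => Fin.succ_ne_zero n (Fin.succ_injective _ (σ.injective h))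
  have hr : Set.range (b ∘ σ) = Set.range b := σ.surjective.range_comp b
  have h1 := hcons b (fun _ _ _ => rfl)
  have h2 := hcons (Function.update (Function.update b i e) j d) (fun n hi hj => by
    rw [Function.update_of_ne hj, Function.update_of_ne hi])
  have h3 := hcons (Function.update b j d) (fun n hi hj => by rw [Function.update_of_ne hj])
  have h4 := hcons (Function.update b i e) (fun n hi hj => by rw [Function.update_of_ne hi])
  have h5 := hcons (Function.update b j e) (fun n hi hj => by rw [Function.update_of_ne hj])
  simp only [Function.update_self, Function.update_of_ne hij, Function.update_of_ne hij.symm]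
    at h2 h3 h4 h5
  have key := h.mul_eq_mul_cons (f := b i) (c := b j) (e := e) (d := d) (β := β)
    (by rw [← h1]; exact (h.injective hb).comp σ.injective) (by rwa [← h1, hr])
    (by rwa [← h1, hr]) hed (by rw [← h5, hm, h0, mul_zero])
  rw [← h1, ← h2, ← h3, ← h4, hm, hm, hm, hm, mul_mul_mul_comm,
    mul_mul_mul_comm _ (φ (Function.update b j d))] at key
  exact mul_left_cancel₀ (mul_ne_zero hc hc) key

end Tract

namespace Tract

open Matroid

variable {G : Type*} [CommGroup G] {G' : Type*} [CommGroup G'] {E : Type*} {T : Tract G}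
  {T' : Tract G'} {M : Matroid E} {k : Flavour} {r : ℕ} {φ : (Fin r → E) → WithZero G}

/-! ### Circuits of Grassmann-Plücker functions -/

lemma range_update {b : Fin r → E} (hb : Function.Injective b) (j : Fin r) (e : E) :
    Set.range (Function.update b j e) = insert e (Set.range b \ {b j}) := by
  ext z
  simp only [Set.mem_range, Set.mem_insert_iff, Set.mem_sdiff, Set.mem_singleton_iff]
  constructor
  · rintro ⟨i, rfl⟩
    by_cases hij : i = j
    · subst hij; simp
    · rw [Function.update_of_ne hij]
      exact Or.inr ⟨⟨i, rfl⟩, fun h => hij (hb h)⟩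
  · rintro (rfl | ⟨⟨i, rfl⟩, hi⟩)
    · exact ⟨j, Function.update_self _ _ _⟩
    · exact ⟨i, Function.update_of_ne (fun h => hi (by rw [h])) _ _⟩

/-- The relation between the values of a circuit vector `X` on `e` and on the entries of a basis
`b` containing the rest of the circuit. -/
def BasisRelation (T : Tract G) (φ : (Fin r → E) → WithZero G) (X : E → WithZero G) (e : E)
    (b : Fin r → E) : Prop :=
  ∀ j, X (b j) * φ b = T.negOne * (φ (Function.update b j e) * X e)

namespace IsGPFunction

lemma notMem_range_of_isCircuit {G₀ : Type*} {φ : (Fin r → E) → WithZero G₀}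
    (hM : IsUnderlyingMatroid φ M) {K : Set E} (hK : M.IsCircuit K)
    {b : Fin r → E} (hb : φ b ≠ 0) {e : E} (hKb : K \ {e} ⊆ Set.range b) :
    e ∉ Set.range b := fun he =>
  hK.not_indep ((hM.isBase hb).indep.subset fun x hx => by
    by_cases hxe : x = e
    · exact hxe ▸ he
    · exact hKb ⟨hx, hxe⟩)

/-- The only circuit inside `insert e (Set.range b)` is `K`, so exchanging `b j` for `e` gives a
base exactly when it breaks `K`. -/
lemma update_ne_zero_iff (h : IsGPFunction k T φ) (hM : IsUnderlyingMatroid φ M) {K : Set E}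
    (hK : M.IsCircuit K) {b : Fin r → E} (hb : φ b ≠ 0) {e : E} (hKb : K \ {e} ⊆ Set.range b)
    (j : Fin r) : φ (Function.update b j e) ≠ 0 ↔ b j ∈ K := by
  have hKi : K ⊆ insert e (Set.range b) := by simpa using hKb
  have he := notMem_range_of_isCircuit hM hK hb hKb
  have hr := range_update (h.injective hb) j e
  constructor
  · intro h0
    by_contra hj
    refine hK.not_indep ((hM.isBase h0).indep.subset fun x hx => ?_)
    rw [hr]
    rcases hKi hx with rfl | hxb
    · exact Or.inl rfl
    · refine Or.inr ⟨hxb, ?_⟩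
      rintro rfl
      exact hj hx
  · intro hj
    refine h.ne_zero_of_isBase hM ?_
    rw [hr]
    refine (hM.isBase hb).exchange_isBase_of_indep he ?_
    rw [indep_iff_forall_subset_not_isCircuit (by rw [hM.1]; exact Set.subset_univ _)]
    intro K' hK's hK'
    have hK'K : K' = K := by
      rw [hK'.eq_fundCircuit_of_subset (hM.isBase hb).indep
        (hK's.trans (Set.insert_subset_insert Set.sdiff_subset)),
        hK.eq_fundCircuit_of_subset (hM.isBase hb).indep hKi]
    rcases hK's (hK'K ▸ hj) with h1 | h1
    · exact he (h1 ▸ ⟨j, rfl⟩)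
    · exact h1.2 rfl

lemma basisRelation_comp (h : IsGPFunction k T φ) {X : E → WithZero G} {e : E} {b : Fin r → E}
    (hX : BasisRelation T φ X e b) (σ : Equiv.Perm (Fin r)) : BasisRelation T φ X e (b ∘ σ) := by
  intro j
  obtain ⟨m, -, hm⟩ := h.apply_comp_perm σ
  have hu : Function.update (b ∘ σ) j e = Function.update b (σ j) e ∘ σ := by
    rw [← Function.update_comp_eq_of_injective _ σ.injective]
  rw [hu, hm, hm, mul_left_comm, Function.comp_apply, hX (σ j)]
  simp only [mul_left_comm, mul_assoc]

/-- The basis relation passes from one basis containing `K \ {e}` to all others. -/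
lemma basisRelation_of_basisRelation [Finite E] (h : IsGPFunction k T φ)
    (hM : IsUnderlyingMatroid φ M) {X : E → WithZero G} (hK : M.IsCircuit (supp X)) {e : E}
    {b b' : Fin r → E} (hb : φ b ≠ 0) (hb' : φ b' ≠ 0)
    (hKb : supp X \ {e} ⊆ Set.range b) (hKb' : supp X \ {e} ⊆ Set.range b')
    (hX : BasisRelation T φ X e b) : BasisRelation T φ X e b' := by
  induction hn : (Set.range b \ Set.range b').ncard using Nat.strong_induction_on
    generalizing b with
  | _ n ih =>
    by_cases hsub : Set.range b ⊆ Set.range b'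
    · obtain ⟨σ, rfl⟩ := exists_perm (h.injective hb)
        ((hM.isBase hb).eq_of_subset_isBase (hM.isBase hb') hsub).symm
      exact h.basisRelation_comp hX σ
    obtain ⟨_, ⟨j₀, rfl⟩, hj₀⟩ := Set.not_subset.1 hsub
    -- One basis exchange at a time. Neither the departing `b j₀` nor the entering `d` lies on the
    -- circuit; the former makes a term of the three-term relation vanish.
    obtain ⟨d, ⟨hdb', hdb⟩, hbase⟩ := (hM.isBase hb).exchange (hM.isBase hb') ⟨⟨j₀, rfl⟩, hj₀⟩
    have heb := notMem_range_of_isCircuit hM hK hb hKb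
    have heb' := notMem_range_of_isCircuit hM hK hb' hKb'
    have hed : e ≠ d := fun hed => heb' (hed ▸ hdb')
    have hdX : X d = 0 := by
      by_contra hd
      exact hdb (hKb ⟨hd, hed.symm⟩)
    have hjX : b j₀ ∉ supp X := fun hj => hj₀ (hKb' ⟨hj, fun h => heb (h ▸ ⟨j₀, rfl⟩)⟩)
    have h0 : φ (Function.update b j₀ e) = 0 := by
      by_contra h0
      exact hjX ((h.update_ne_zero_iff hM hK hb hKb j₀).1 h0)
    have hr := range_update (h.injective hb) j₀ d
    have hb1 : φ (Function.update b j₀ d) ≠ 0 := h.ne_zero_of_isBase hM (hr ▸ hbase)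
    refine ih _ ?_ hb1 ?_ ?_ rfl
    · rw [← hn, hr]
      refine Set.ncard_lt_ncard ⟨?_, fun hs => ?_⟩ (Set.toFinite _)
      · rintro x ⟨rfl | hx, hx'⟩
        · exact absurd hdb' hx'
        · exact ⟨hx.1, hx'⟩
      · rcases (hs ⟨⟨j₀, rfl⟩, hj₀⟩).1 with h1 | h1
        · exact hdb (h1 ▸ ⟨j₀, rfl⟩)
        · exact h1.2 rfl
    · intro x hx
      rw [hr]
      refine Or.inr ⟨hKb hx, ?_⟩
      rintro rfl
      exact hjX hx.1
    · intro j
      by_cases hj : j = j₀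
      · subst hj
        rw [Function.update_self, hdX, Function.update_idem, h0, zero_mul, zero_mul, mul_zero]
      · have key := h.mul_eq_mul_update hb hj heb hdb hed h0
        apply mul_left_cancel₀ hb
        rw [Function.update_of_ne hj, Function.update_comm (Ne.symm hj)]
        calc φ b * (X (b j) * φ (Function.update b j₀ d))
            = X (b j) * φ b * φ (Function.update b j₀ d) := by ac_rfl
          _ = T.negOne * (φ (Function.update b j₀ d) * φ (Function.update b j e)) * X e := by
              rw [hX j]; ac_rfl
          _ = T.negOne * (φ b * φ (Function.update (Function.update b j e) j₀ d)) * X e := by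
              rw [key]
          _ = _ := by ac_rfl

/-- The basis relation passes from one element of the circuit to all others. -/
lemma basisRelation_of_mem (h : IsGPFunction k T φ)
    (hM : IsUnderlyingMatroid φ M) {X : E → WithZero G} (hK : M.IsCircuit (supp X)) {e : E}
    (he : e ∈ supp X)
    (hX : ∀ b : Fin r → E, φ b ≠ 0 → supp X \ {e} ⊆ Set.range b → BasisRelation T φ X e b)
    {e' : E} {b : Fin r → E} (hb : φ b ≠ 0)
    (hKb : supp X \ {e'} ⊆ Set.range b) : BasisRelation T φ X e' b := by
  by_cases hee : e' = e
  · exact hee ▸ hX b hb (hee ▸ hKb)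
  -- Since `e` occurs in `b`, at slot `j₁`, putting `e'` there gives a basis to which the relation
  -- at `e` applies. Undoing the exchange costs a transposition, whose sign cancels.
  obtain ⟨j₁, hj₁⟩ := hKb ⟨he, fun h => hee h.symm⟩
  have hb1 : φ (Function.update b j₁ e') ≠ 0 :=
    (h.update_ne_zero_iff hM hK hb hKb j₁).2 (hj₁ ▸ he)
  have hQ := hX _ hb1 (by
    rintro x ⟨hx, hxe⟩
    rw [range_update (h.injective hb)]
    by_cases hxe' : x = e'
    · exact Or.inl hxe'
    · exact Or.inr ⟨hKb ⟨hx, hxe'⟩, fun h => hxe (by rw [← hj₁]; exact h)⟩)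
  have h1 : X e' * φ (Function.update b j₁ e') = T.negOne * (φ b * X e) := by
    have := hQ j₁
    rwa [Function.update_self, Function.update_idem, show Function.update b j₁ e = b by
      rw [← hj₁, Function.update_eq_self]] at this
  intro j
  by_cases hj : j = j₁
  · subst hj
    rw [hj₁, mul_comm _ (X e'), h1, negOne_mul_cancel_left, mul_comm]
  · have h2 := hQ j
    have hu : Function.update (Function.update b j₁ e') j e =
        Function.update b j e' ∘ Equiv.swap j j₁ := by
      funext i
      rw [Function.comp_apply]
      by_cases hij : i = j
      · subst hij
        rw [Function.update_self, Equiv.swap_apply_left, Function.update_of_ne (Ne.symm hj), hj₁]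
      · by_cases hij₁ : i = j₁
        · subst hij₁
          rw [Function.update_of_ne hij, Function.update_self, Equiv.swap_apply_right,
            Function.update_self]
        · rw [Function.update_of_ne hij, Function.update_of_ne hij₁,
            Equiv.swap_apply_of_ne_of_ne hij hij₁, Function.update_of_ne hij]
    rw [Function.update_of_ne hj, hu, h.map_swap _ _ _ hj, mul_assoc, negOne_mul_cancel_left] at h2
    apply mul_right_cancel₀ hb1
    calc X (b j) * φ b * φ (Function.update b j₁ e')
        = (X (b j) * φ (Function.update b j₁ e')) * φ b := mul_right_comm _ _ _
      _ = φ (Function.update b j e') * (φ b * X e) := by rw [h2, mul_assoc, mul_comm (X e)]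
      _ = φ (Function.update b j e') *
            (T.negOne * (X e' * φ (Function.update b j₁ e'))) := by
          rw [h1, negOne_mul_cancel_left]
      _ = _ := by simp only [mul_assoc, mul_left_comm]

/-- Every circuit of the underlying matroid supports a circuit of the Grassmann-Plücker
function. -/
theorem exists_mem_gpCircuits [Finite E] (h : IsGPFunction k T φ) (hM : IsUnderlyingMatroid φ M)
    {K : Set E} (hK : M.IsCircuit K) : ∃ X ∈ gpCircuits T φ, supp X = K := by
  classical
  obtain ⟨e, he⟩ := hK.nonempty
  obtain ⟨B, hB, hKB⟩ := (hK.sdiff_singleton_indep he).exists_isBase_superset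
  obtain ⟨b, rfl, hb⟩ := (hM.2 B).1 hB
  have heb := notMem_range_of_isCircuit hM hK hb hKB
  -- The vector is normalised at `e` and read off from the single basis `b`;
  -- `basisRelation_of_basisRelation` and `basisRelation_of_mem` show that these choices do not
  -- matter.
  let X : E → WithZero G := fun g =>
    if g = e then 1 else
      if hg : ∃ j, b j = g then T.negOne * (φ (Function.update b hg.choose e) / φ b) else 0
  have hXe : X e = 1 := if_pos rfl
  have hXb : ∀ j, X (b j) = T.negOne * (φ (Function.update b j e) / φ b) := by
    intro j
    have hne : b j ≠ e := fun h => heb ⟨j, h⟩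
    have hex : ∃ i, b i = b j := ⟨j, rfl⟩
    simp only [X, if_neg hne, dif_pos hex]
    rw [h.injective hb hex.choose_spec]
  have hs : supp X = K := by
    ext g
    rw [mem_supp]
    by_cases hge : g = e
    · subst hge
      simp [hXe, he]
    by_cases hg : g ∈ Set.range b
    · obtain ⟨j, rfl⟩ := hg
      rw [hXb, ← h.update_ne_zero_iff hM hK hb hKB j]
      simp [T.negOne_ne_zero, hb]
    · have h1 : X g = 0 := by
        simp only [X, if_neg hge]
        exact dif_neg hg
      simp only [h1, ne_eq, not_true_eq_false, false_iff]
      exact fun hgK => hg (hKB ⟨hgK, hge⟩)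
  subst hs
  have hX0 : BasisRelation T φ X e b := fun j => by
    rw [hXb, hXe, mul_one, mul_assoc, div_mul_cancel₀ _ hb]
  refine ⟨X, ⟨M, hM, hK, fun x hx0 hx hsub i => ?_⟩, rfl⟩
  refine Fin.cases ?_ (fun j => ?_) i
  · rw [div_self hx0, Fin.succAbove_zero, div_self hx, Fin.val_zero, pow_zero, one_mul]
  · have hrel := h.basisRelation_of_mem hM hK he (fun b' hb' hKb' =>
      h.basisRelation_of_basisRelation hM hK hb hb' hKB hKb' hX0) hx hsub j
    rw [h.apply_comp_succAbove, Fin.val_succ, div_eq_iff hx0, mul_div_assoc',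
      div_mul_eq_mul_div, eq_div_iff hx]
    rw [Function.comp_apply] at hrel
    rw [hrel, ← mul_assoc (T.negOne ^ _), pow_succ, mul_right_comm (T.negOne ^ _), ← mul_pow,
      negOne_mul_negOne, one_pow, one_mul, mul_assoc]

end IsGPFunction

/-- Circuits of a Grassmann-Plücker function with the same support are proportional. -/
lemma exists_smul_of_mem_gpCircuits {X Y : E → WithZero G} (hX : X ∈ gpCircuits T φ)
    (hY : Y ∈ gpCircuits T φ) (hXY : supp X = supp Y) :
    ∃ α : G, X = fun e => (α : WithZero G) * Y e := by
  obtain ⟨M, hM, hK, hXr⟩ := hX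
  obtain ⟨-, -, -, hYr⟩ := hY
  obtain ⟨e, he⟩ := hK.nonempty
  have he' : e ∈ supp Y := hXY ▸ he
  obtain ⟨B, hB, hKB⟩ := (hK.sdiff_singleton_indep he).exists_isBase_superset
  obtain ⟨b, rfl, hb⟩ := (hM.2 B).1 hB
  let x : Fin (r + 1) → E := Fin.cons e b
  have hxs : x ∘ Fin.succ = b := rfl
  have h1 := hXr x he (by rwa [hxs]) (by rw [hxs]; exact hKB)
  have h2 := hYr x he' (by rwa [hxs]) (by rw [hxs, ← hXY]; exact hKB)
  obtain ⟨α, hα⟩ := WithZero.ne_zero_iff_exists.1 (mul_ne_zero he (inv_ne_zero he'))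
  refine ⟨α, funext fun g => ?_⟩
  rw [hα]
  by_cases hg : g ∈ supp X
  swap
  · have hg' : g ∉ supp Y := hXY ▸ hg
    rw [notMem_supp.1 hg, notMem_supp.1 hg', mul_zero]
  obtain ⟨i, rfl⟩ : g ∈ Set.range x := by
    rw [Fin.range_cons]
    by_cases hge : g = e
    · exact Or.inl hge
    · exact Or.inr (hKB ⟨hg, hge⟩)
  have h3 : X (x i) / X e = Y (x i) / Y e := (h1 i).trans (h2 i).symm
  rw [div_eq_iff he] at h3
  rw [h3, div_eq_mul_inv]
  ac_rfl

/-! ### Push-forward of Grassmann-Plücker functions -/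

lemma pushGP_ne_zero_iff (f : Hom T T') {x : Fin r → E} : f.pushGP φ x ≠ 0 ↔ φ x ≠ 0 :=
  f.map_eq_zero_iff.not

lemma isUnderlyingMatroid_pushGP (f : Hom T T') :
    IsUnderlyingMatroid (f.pushGP φ) M ↔ IsUnderlyingMatroid φ M := by
  simp only [IsUnderlyingMatroid, pushGP_ne_zero_iff]

lemma gpSum_pushGP_mem_null {s : ℕ} {φ : (Fin (s + 1) → E) → WithZero G} (f : Hom T T')
    {x : Fin (s + 2) → E} {y : Fin s → E} (h : gpSum T φ x y ∈ T.null) :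
    gpSum T' (f.pushGP φ) x y ∈ T'.null := by
  have := f.sum_mem_null _ h
  simpa only [gpSum, Hom.pushGP, f.map_mul, f.map_pow, f.map_negOne] using this

/-- The push-forward of a Grassmann-Plücker function is a Grassmann-Plücker function. -/
theorem IsGPFunction.push (h : IsGPFunction k T φ) (f : Hom T T') :
    IsGPFunction k T' (f.pushGP φ) where
  exists_ne_zero := h.exists_ne_zero.imp fun _ hx => (pushGP_ne_zero_iff f).2 hx
  map_swap x i j hij := by
    rw [Hom.pushGP, h.map_swap x i j hij, f.map_mul, f.map_negOne]
    rfl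
  map_eq_zero x i j hij hx := by rw [Hom.pushGP, h.map_eq_zero x i j hij hx, f.map_zero]
  relations := by
    cases k with
    | weak =>
      obtain ⟨⟨M, hM⟩, hrel⟩ := h.relations
      refine ⟨⟨M, (isUnderlyingMatroid_pushGP f).2 hM⟩, ?_⟩
      cases r with
      | zero => trivial
      | succ s => exact fun x y hx hy hxy => gpSum_pushGP_mem_null f (hrel x y hx hy hxy)
    | strong =>
      have hrel := h.relations
      cases r with
      | zero => trivial
      | succ s => exact fun x y hx hy => gpSum_pushGP_mem_null f (hrel x y hx hy)

/-- The circuits of the push-forward of a Grassmann-Plücker function. -/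
theorem IsGPFunction.gpCircuits_pushGP [Finite E] (h : IsGPFunction k T φ) (f : Hom T T') :
    gpCircuits T' (f.pushGP φ) = f.pushSet (gpCircuits T φ) := by
  have hsub : f.pushSet (gpCircuits T φ) ⊆ gpCircuits T' (f.pushGP φ) := by
    rintro _ ⟨c, X, ⟨M, hM, hK, hX⟩, rfl⟩
    refine ⟨M, (isUnderlyingMatroid_pushGP f).2 hM, ?_, ?_⟩
    · rwa [supp_smul WithZero.coe_ne_zero, supp_map]
    · rw [supp_smul WithZero.coe_ne_zero, supp_map]
      intro x hx0 hx hs i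
      rw [mul_div_mul_left _ _ WithZero.coe_ne_zero, ← f.map_div,
        hX x hx0 ((pushGP_ne_zero_iff f).1 hx) hs i, f.map_mul, f.map_pow, f.map_negOne, f.map_div]
      rfl
  -- Pushing forward does not change where `φ` vanishes, so the circuit of `X'` already supports a
  -- pushed vector, proportional to `X'`.
  refine Set.Subset.antisymm (fun X' hX' => ?_) hsub
  obtain ⟨M, hM, hK, -⟩ := id hX'
  obtain ⟨X, hX, hs⟩ := h.exists_mem_gpCircuits ((isUnderlyingMatroid_pushGP f).1 hM) hK
  have hX1 : (fun e => ((1 : G') : WithZero G') * f.map (X e)) ∈ f.pushSet (gpCircuits T φ) :=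
    ⟨1, X, hX, rfl⟩
  obtain ⟨α, hα⟩ := exists_smul_of_mem_gpCircuits hX' (hsub hX1)
    (by rw [supp_smul WithZero.coe_ne_zero, supp_map, hs])
  exact ⟨α, X, hX, by simpa using hα⟩

end Tract

/-! ### The main theorem -/

theorem mainTheorem11 {G G' E : Type*} [CommGroup G] [CommGroup G'] [Fintype E]
    (k : Tract.Flavour) {T : Tract G} {T' : Tract G'}
    (τ : T.Involution) (τ' : T'.Involution) (f : Tract.Hom T T')
    (hf : ∀ x : WithZero G, f.map (τ.map x) = τ'.map (f.map x))
    (M : Tract.FMatroid k T E) :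
    ∃ (Mdual : Tract.FMatroid k T E) (N Ndual : Tract.FMatroid k T' E),
      M.IsDual τ Mdual ∧
      -- (1) `N` is the matroid with circuits `c' f_*(X)`, `X` a circuit of `M`
      N.circuits = f.pushSet M.circuits ∧
      -- (2) `N` is the one matroid with cocircuits `c' f_*(Y)`, `Y` a circuit of the dual of `M`
      (∀ N' : Tract.FMatroid k T' E,
        N'.cocircuits τ' = f.pushSet Mdual.circuits ↔ N' = N) ∧
      -- (3) `N` is the one matroid with Grassmann-Plücker function `f_* φ`
      (∀ (r : ℕ) (φ : (Fin r → E) → WithZero G), M.HasGPFunction φ →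
        Tract.IsGPFunction k T' (f.pushGP φ) ∧
        ∀ N' : Tract.FMatroid k T' E, N'.HasGPFunction (f.pushGP φ) ↔ N' = N) ∧
      -- push-forward commutes with duality
      N.IsDual τ' Ndual ∧ Ndual.circuits = f.pushSet Mdual.circuits := by
  obtain ⟨Mdual, hMdual⟩ := M.exists_isDual τ
  obtain ⟨N, hN⟩ := M.exists_push f
  obtain ⟨Ndual, hNdual⟩ := N.exists_isDual τ'
  have hco : N.cocircuits τ' = f.pushSet Mdual.circuits := by
    rw [Tract.FMatroid.cocircuits_push hf hN, hMdual]
  refine ⟨Mdual, N, Ndual, hMdual, hN, fun N' => ⟨fun h => ?_, fun h => h ▸ hco⟩,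
    fun r φ hφ => ⟨hφ.1.push f, fun N' => ?_⟩, hNdual, hNdual.trans hco⟩
  -- Equal cocircuits mean a common dual, and both matroids are then recovered as the dual of
  -- `Ndual`.
  · have hN' : N'.IsDual τ' Ndual := by
      rw [Tract.FMatroid.IsDual, h, ← hco]
      exact hNdual
    exact Tract.FMatroid.ext (hN'.symm.trans (Eq.symm hNdual.symm))
  · have hcirc : Tract.gpCircuits T' (f.pushGP φ) = N.circuits := by
      rw [hφ.1.gpCircuits_pushGP f, ← hφ.2, hN]
    constructor
    · intro h
      exact Tract.FMatroid.ext (h.2.trans hcirc)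
    · rintro rfl
      exact ⟨hφ.1.push f, hcirc.symm⟩
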